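/- Theorem. Let $m\le n$, let $\mathcal A:\mathbb R^{m\times n}\to\mathbb R^l$ be a linear map, and let $p\in(0,1)$. For $X\in\mathbb R^{m\times n}$ let $\sigma_1(X)\ge\dots\ge\sigma_m(X)\ge 0$ be its singular values, let $\|X\|_p=\bigl(\sum_{i=1}^{m}\sigma_i(X)^p\bigr)^{1/p}$ be its Schatten $p$-quasi-norm and $\|X\|_F$ its Frobenius norm; for $y\in\mathbb R^l$ let $\|y\|_2$ be the Euclidean norm and $\|y\|_p^p=\sum_{i=1}^{l}|y_i|^p$. Say that $\bar X\in\mathbb R^{m\times n}$ is exactly recovered by Schatten $p$-minimization if $\bar X$ is the unique optimal solution of the problem of minimizing $\|X\|_p^p$ over all $X\in\mathbb R^{m\times n}$ with $\mathcal A(X)=\mathcal A(\bar X)$. (a) Let $k\ge 1$ be an integer with $2k\le m$. Suppose that there is a constant $\alpha_{2k}\in(0,1)$ such that $$(1-\alpha_{2k})\|X\|_F^2\le\|\mathcal A(X)\|_2^2\le(1+\alpha_{2k})\|X\|_F^2$$ for all $X\in\mathbb R^{m\times n}$ with $\operatorname{rank}(X)\le 2k$, and that $p<\min\{1,\,1.0873\,(1-\alpha_{2k})\}$.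 Then every $\bar X\in\mathbb R^{m\times n}$ with $\operatorname{rank}(\bar X)\le k$ is exactly recovered by Schatten $p$-minimization. (b) Let $k\ge 1$ be an integer, let $b>1$ be real, and let $a=\lceil b^{2/(2-p)}k\rceil/k$, so that $ak$ and $(a+1)k$ are integers. Suppose that for each $r\in\{ak,(a+1)k\}$ there is a constant $\beta_{p,r}\in(0,1)$ such that $$(1-\beta_{p,r})\|X\|_F^p\le\|\mathcal A(X)\|_p^p\le(1+\beta_{p,r})\|X\|_F^p$$ for all $X\in\mathbb R^{m\times n}$ with $\operatorname{rank}(X)\le r$, and that $\beta_{p,ak}+b\,\beta_{p,(a+1)k}<b-1$. Then every $\bar X\in\mathbb R^{m\times n}$ with $\operatorname{rank}(\bar X)\le k$ is exactly recovered by Schatten $p$-minimization. -/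

import Mathlib

noncomputable section

namespace SchattenRecovery

/-- The singular value `σ_{i+1}(X)` of a real `m × n` matrix: the singular values of the linear map
`ℝⁿ → ℝᵐ` given by `X` between Euclidean spaces, in decreasing order, indexed from `0`. -/
def singularValue {m n : ℕ} (X : Matrix (Fin m) (Fin n) ℝ) (i : ℕ) : ℝ :=
  (Matrix.toEuclideanLin X).singularValues i

/-- The Schatten `p`-quasi-norm `(∑_{i=1}^{min{m,n}} σ_i(X)^p)^{1/p}`. -/
def schattenNorm {m n : ℕ} (p : ℝ) (X : Matrix (Fin m) (Fin n) ℝ) : ℝ :=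
  (∑ i ∈ Finset.range (min m n), singularValue X i ^ p) ^ (1 / p)

section

attribute [local instance] Matrix.frobeniusNormedAddCommGroup

/-- The Frobenius norm of a matrix. -/
def frobeniusNorm {m n : ℕ} (X : Matrix (Fin m) (Fin n) ℝ) : ℝ := ‖X‖

end

/-- The restricted isometry property for matrices of rank at most `r`, with constant
`α ∈ (0,1)`. -/
def HasRIP {m n l : ℕ} (A : Matrix (Fin m) (Fin n) ℝ →ₗ[ℝ] EuclideanSpace ℝ (Fin l))
    (r : ℕ) (α : ℝ) : Prop :=
  (0 < α ∧ α < 1) ∧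
    ∀ X : Matrix (Fin m) (Fin n) ℝ, X.rank ≤ r →
      (1 - α) * frobeniusNorm X ^ 2 ≤ ‖A X‖ ^ 2 ∧
        ‖A X‖ ^ 2 ≤ (1 + α) * frobeniusNorm X ^ 2

/-- The restricted `p`-isometry property for matrices of rank at most `r`, with constant
`β ∈ (0,1)`; here `‖y‖_p^p = ∑ᵢ |yᵢ|^p` for `y ∈ ℝˡ`. -/
def HasRestrictedPIsometry {m n l : ℕ}
    (A : Matrix (Fin m) (Fin n) ℝ →ₗ[ℝ] EuclideanSpace ℝ (Fin l))
    (p : ℝ) (r : ℕ) (β : ℝ) : Prop :=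
  (0 < β ∧ β < 1) ∧
    ∀ X : Matrix (Fin m) (Fin n) ℝ, X.rank ≤ r →
      (1 - β) * frobeniusNorm X ^ p ≤ ∑ i, |A X i| ^ p ∧
        ∑ i, |A X i| ^ p ≤ (1 + β) * frobeniusNorm X ^ p

/-- `X` is an optimal solution of: minimize `‖X‖_p^p` subject to `‖A(X) - y‖₂ ≤ η`. -/
def IsOptimal {m n l : ℕ} (A : Matrix (Fin m) (Fin n) ℝ →ₗ[ℝ] EuclideanSpace ℝ (Fin l))
    (p : ℝ) (y : EuclideanSpace ℝ (Fin l)) (η : ℝ) (X : Matrix (Fin m) (Fin n) ℝ) : Prop :=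
  ‖A X - y‖ ≤ η ∧
    ∀ X' : Matrix (Fin m) (Fin n) ℝ, ‖A X' - y‖ ≤ η →
      schattenNorm p X ^ p ≤ schattenNorm p X' ^ p

/-- `Xbar` is exactly recovered from `y = A(Xbar)` by Schatten `p`-minimization with `η = 0`:
it is the unique optimal solution. -/
def ExactlyRecovered {m n l : ℕ}
    (A : Matrix (Fin m) (Fin n) ℝ →ₗ[ℝ] EuclideanSpace ℝ (Fin l))
    (p : ℝ) (Xbar : Matrix (Fin m) (Fin n) ℝ) : Prop :=
  ∀ X : Matrix (Fin m) (Fin n) ℝ, IsOptimal A p (A Xbar) 0 X ↔ X = Xbar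

end SchattenRecovery

end

/-!
Both parts follow from a null space property: every nonzero `Z` in the kernel of `A` satisfies
`∑_{i < k} σ_i(Z)^p < ∑_{i ≥ k} σ_i(Z)^p`.

The null space property gives recovery through the perturbation inequality
`∑ |σ_i(S)^p - σ_i(T)^p| ≤ ∑ σ_i(S - T)^p` (`LinearMap.sum_abs_rpow_singularValues_sub_le`), applied
to `S = Xbar` and `T = Xbar - X` for a competitor `X`: the singular values of `Xbar` vanish from the
index `k` on. By the singular value decomposition of `S - T` the inequality reduces to a rank-one
perturbation of norm `c`. There the two sequences of singular values interlace, so the intervals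
between corresponding singular values are disjoint, and by concavity of `t ^ p` it is enough that
their total length is at most `c` (`LinearMap.sum_abs_singularValues_sub_le`). For this, both maps
are dilated to symmetric operators on `F × E`, whose quadratic forms `2 ⟨y, A x⟩` and `2 ⟨y, B x⟩`
lie below the form of one operator `dilation A c u v` of trace at most `c`; the top eigenvalues of
that operator bound the singular values of `A` and `B` from above and the negatives of the bottom
ones bound them from below.

The null space property concerns only the decreasing sequence `h_i = σ_i(Z)`, since sums of terms of
the singular value decomposition of `Z` have rank at most the number of terms and their squared
Frobenius norm is the sum of the `h_i ^ 2`. Suppose it fails, and cut the sequence after the first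
`k` entries into blocks. The images of the head and the first block cancel those of the later
blocks. Each entry of a block is at most the `p`-mean of the previous block, and the `p`-masses of
the blocks add up to at most the `p`-mass of the head, so the later blocks are small.

* With the isometry property (`VectorRIP.sum_rpow_lt`) the blocks have length `k`, and the image of
  the later blocks has squared norm at most `α F ^ 2 + G`, where `F` is the sum of their norms and
  `G` the sum of their squared norms, because images of orthogonal blocks are nearly orthogonal. In
  units of the squared norm of the head, `G ≤ p / 4`, `F ^ 2 ≤ 1`, and `F ^ 2 ≤ p / (2 (1 - p))` for
  `p < 2 / 3`. For `p < 1.0873 (1 - α)` this makes `α F ^ 2 + G` smaller than `1 - α`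
  (`tail_bound_lt`), which the isometry property forbids.
* With the `p`-isometry property (`sum_rpow_lt_of_restricted_pIsometry`) the blocks have length
  `M ≥ b ^ (2 / (2 - p)) k`, and the triangle inequality for `∑ |y_i| ^ p` is enough.
-/

open Module

/-! ### Courant–Fischer bounds -/

section MinMax

variable {V : Type*} [NormedAddCommGroup V] [InnerProductSpace ℝ V]

theorem Submodule.exists_mem_ne_zero_of_lt_finrank {V : Type*} [AddCommGroup V] [Module ℝ V]
    (U : Submodule ℝ V) {i : ℕ} (hi : i < finrank ℝ U) (g : V →ₗ[ℝ] (Fin i → ℝ)) :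
    ∃ z ∈ U, z ≠ 0 ∧ g z = 0 := by
  have : FiniteDimensional ℝ U := FiniteDimensional.of_finrank_pos (by omega)
  have h : LinearMap.ker (g ∘ₗ U.subtype) ≠ ⊥ :=
    LinearMap.ker_ne_bot_of_finrank_lt (by simpa using hi)
  obtain ⟨z, hz, hz0⟩ := Submodule.exists_mem_ne_zero_of_ne_bot h
  exact ⟨z, z.2, by simpa using hz0, by simpa using hz⟩

/-- The map sending a vector to its inner products with a finite family. -/
noncomputable def innerFamily {ι : Type*} (w : ι → V) : V →ₗ[ℝ] (ι → ℝ) :=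
  LinearMap.pi fun j => (innerSL ℝ (w j)).toLinearMap

@[simp] theorem innerFamily_apply {ι : Type*} (w : ι → V) (z : V) (j : ι) :
    innerFamily w z j = inner ℝ (w j) z := rfl

theorem innerFamily_eq_zero {ι : Type*} {w : ι → V} {z : V} :
    innerFamily w z = 0 ↔ ∀ j, inner ℝ (w j) z = 0 := by
  simp [funext_iff]

/-- The span of the first `i + 1` vectors of an orthonormal basis meets every subspace cut out by
`i` linear equations. -/
theorem OrthonormalBasis.exists_ne_zero_inner_eq_zero_of_gt {N : ℕ}
    (e : OrthonormalBasis (Fin N) ℝ V) {i : ℕ} (hi : i < N) (g : V →ₗ[ℝ] (Fin i → ℝ)) :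
    ∃ z, z ≠ 0 ∧ g z = 0 ∧ ∀ j : Fin N, i < j → inner ℝ (e j) z = 0 := by
  let w : Fin (i + 1) → V := fun j => e (Fin.castLE hi j)
  have hw : LinearIndependent ℝ w :=
    e.orthonormal.linearIndependent.comp _ (Fin.castLE_injective hi)
  obtain ⟨z, hzU, hz0, hgz⟩ := (Submodule.span ℝ (Set.range w)).exists_mem_ne_zero_of_lt_finrank
    (i := i) (by rw [finrank_span_eq_card hw]; simp) g
  refine ⟨z, hz0, hgz, fun j hj => ?_⟩
  have hle : Submodule.span ℝ (Set.range w) ≤ LinearMap.ker (innerSL ℝ (e j)).toLinearMap := by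
    rw [Submodule.span_le]
    rintro _ ⟨a, rfl⟩
    refine e.orthonormal.2 fun h => ?_
    have := congrArg Fin.val h
    simp at this
    omega
  exact hle hzU

section Diagonal

variable {N : ℕ} {e : OrthonormalBasis (Fin N) ℝ V} {T : V →ₗ[ℝ] V} {h : Fin N → ℝ}

theorem inner_apply_eq_sum_of_diagonal (hT : ∀ j, T (e j) = h j • e j) (z : V) :
    inner ℝ z (T z) = ∑ j, h j * inner ℝ (e j) z ^ 2 := by
  have hz : T z = ∑ j, inner ℝ (e j) z • h j • e j := by
    conv_lhs => rw [← e.sum_repr' z]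
    simp [hT]
  rw [hz, inner_sum]
  refine Finset.sum_congr rfl fun j _ => ?_
  rw [inner_smul_right, inner_smul_right, real_inner_comm]
  ring

theorem OrthonormalBasis.sum_inner_sq (e : OrthonormalBasis (Fin N) ℝ V) (z : V) :
    ∑ j, inner ℝ (e j) z ^ 2 = ‖z‖ ^ 2 := by
  simpa using e.sum_sq_norm_inner_right z

/-- Courant–Fischer, lower bound: the Rayleigh quotient is at least `t` on a subspace of dimension
greater than `i`. -/
theorem le_of_diagonal_of_forall_mem (hT : ∀ j, T (e j) = h j • e j) (hh : Antitone h)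
    (i : Fin N) {t : ℝ} (U : Submodule ℝ V) (hi : (i : ℕ) < finrank ℝ U)
    (hU : ∀ z ∈ U, t * ‖z‖ ^ 2 ≤ inner ℝ z (T z)) : t ≤ h i := by
  obtain ⟨z, hzU, hz0, hz⟩ := U.exists_mem_ne_zero_of_lt_finrank hi
    (innerFamily fun j : Fin i => e (Fin.castLE i.2.le j))
  rw [innerFamily_eq_zero] at hz
  have hle : t * ‖z‖ ^ 2 ≤ h i * ‖z‖ ^ 2 := by
    refine (hU z hzU).trans ?_
    rw [inner_apply_eq_sum_of_diagonal hT, ← e.sum_inner_sq, Finset.mul_sum]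
    refine Finset.sum_le_sum fun j _ => ?_
    rcases lt_or_ge j i with hj | hj
    · have := hz ⟨j, hj⟩
      have h0 : inner ℝ (e j) z = 0 := this
      simp [h0]
    · exact mul_le_mul_of_nonneg_right (hh hj) (sq_nonneg _)
  exact le_of_mul_le_mul_right hle (by positivity)

/-- Courant–Fischer, upper bound: the Rayleigh quotient is at most `t` on a subspace cut out by `i`
linear equations. -/
theorem le_of_diagonal_of_forall_eq_zero (hT : ∀ j, T (e j) = h j • e j) (hh : Antitone h)
    (i : Fin N) {t : ℝ} (g : V →ₗ[ℝ] (Fin i → ℝ))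
    (hg : ∀ z, g z = 0 → inner ℝ z (T z) ≤ t * ‖z‖ ^ 2) : h i ≤ t := by
  obtain ⟨z, hz0, hgz, hz⟩ := e.exists_ne_zero_inner_eq_zero_of_gt i.2 g
  have hle : h i * ‖z‖ ^ 2 ≤ t * ‖z‖ ^ 2 := by
    refine le_trans ?_ (hg z hgz)
    rw [inner_apply_eq_sum_of_diagonal hT, ← e.sum_inner_sq, Finset.mul_sum]
    refine Finset.sum_le_sum fun j _ => ?_
    rcases lt_or_ge i j with hj | hj
    · simp [hz j hj]
    · exact mul_le_mul_of_nonneg_right (hh hj) (sq_nonneg _)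
  exact le_of_mul_le_mul_right hle (by positivity)

/-- The upper Courant–Fischer bound for `-T`, whose `i`-th eigenvalue is `-h (N - 1 - i)`. -/
theorem neg_rev_le_of_diagonal_of_forall_eq_zero (hT : ∀ j, T (e j) = h j • e j)
    (hh : Antitone h) (i : Fin N) {t : ℝ} (g : V →ₗ[ℝ] (Fin i → ℝ))
    (hg : ∀ z, g z = 0 → -(t * ‖z‖ ^ 2) ≤ inner ℝ z (T z)) : -h i.rev ≤ t := by
  refine le_of_diagonal_of_forall_eq_zero (e := e.reindex Fin.revPerm) (T := -T)
    (h := fun j => -h j.rev) ?_ ?_ i g ?_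
  · intro j
    simp [hT]
  · intro a b hab
    simpa using hh (Fin.rev_le_rev.2 hab)
  · intro z hz
    have := hg z hz
    simp only [LinearMap.neg_apply, inner_neg_right]
    linarith

end Diagonal

end MinMax

/-! ### Right singular vectors -/

section SingularValues

variable {E F : Type*} [NormedAddCommGroup E] [InnerProductSpace ℝ E] [FiniteDimensional ℝ E]
  [NormedAddCommGroup F] [InnerProductSpace ℝ F] [FiniteDimensional ℝ F]

namespace LinearMap

/-- The right singular vectors of a linear map, in decreasing order of the singular values. -/
noncomputable def rightSingularBasis (T : E →ₗ[ℝ] F) :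
    OrthonormalBasis (Fin (finrank ℝ E)) ℝ E :=
  T.isSymmetric_adjoint_comp_self.eigenvectorBasis rfl

theorem adjoint_comp_self_rightSingularBasis (T : E →ₗ[ℝ] F) (j : Fin (finrank ℝ E)) :
    (T.adjoint ∘ₗ T) (T.rightSingularBasis j) =
      (T.singularValues j ^ 2) • T.rightSingularBasis j := by
  rw [T.sq_singularValues_fin rfl]
  exact T.isSymmetric_adjoint_comp_self.apply_eigenvectorBasis rfl j

theorem inner_apply_rightSingularBasis (T : E →ₗ[ℝ] F) (i j : Fin (finrank ℝ E)) :
    inner ℝ (T (T.rightSingularBasis i)) (T (T.rightSingularBasis j)) =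
      if i = j then T.singularValues j ^ 2 else 0 := by
  rw [← LinearMap.adjoint_inner_right, ← LinearMap.comp_apply,
    T.adjoint_comp_self_rightSingularBasis, inner_smul_right,
    orthonormal_iff_ite.1 T.rightSingularBasis.orthonormal]
  simp

theorem norm_apply_rightSingularBasis (T : E →ₗ[ℝ] F) (j : Fin (finrank ℝ E)) :
    ‖T (T.rightSingularBasis j)‖ = T.singularValues j := by
  have h := T.inner_apply_rightSingularBasis j j
  rw [real_inner_self_eq_norm_sq, if_pos rfl] at h
  exact (sq_eq_sq₀ (norm_nonneg _) (T.singularValues_nonneg _)).1 h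

theorem inner_adjoint_comp_self (T : E →ₗ[ℝ] F) (z : E) :
    inner ℝ z ((T.adjoint ∘ₗ T) z) = ‖T z‖ ^ 2 := by
  rw [LinearMap.comp_apply, LinearMap.adjoint_inner_right, real_inner_self_eq_norm_sq]

theorem antitone_sq_singularValues (T : E →ₗ[ℝ] F) :
    Antitone fun j : Fin (finrank ℝ E) => T.singularValues j ^ 2 := fun _ _ hab =>
  pow_le_pow_left₀ (T.singularValues_nonneg _) (T.singularValues_antitone hab) 2

/-- Vectors orthogonal to the first `i` right singular vectors are stretched by at most the
`i`-th singular value. -/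
theorem norm_apply_le_singularValues (T : E →ₗ[ℝ] F) (i : ℕ) {x : E}
    (hx : ∀ j : Fin (finrank ℝ E), (j : ℕ) < i → inner ℝ (T.rightSingularBasis j) x = 0) :
    ‖T x‖ ≤ T.singularValues i * ‖x‖ := by
  refine le_of_sq_le_sq ?_ (mul_nonneg (T.singularValues_nonneg _) (norm_nonneg _))
  rw [← T.inner_adjoint_comp_self,
    inner_apply_eq_sum_of_diagonal T.adjoint_comp_self_rightSingularBasis, mul_pow,
    ← T.rightSingularBasis.sum_inner_sq, Finset.mul_sum]
  refine Finset.sum_le_sum fun j _ => ?_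
  rcases lt_or_ge (j : ℕ) i with hj | hj
  · simp [hx j hj]
  · exact mul_le_mul_of_nonneg_right
      (pow_le_pow_left₀ (T.singularValues_nonneg _) (T.singularValues_antitone hj) 2)
      (sq_nonneg _)

theorem singularValues_le_of_forall_eq_zero (T : E →ₗ[ℝ] F) (i : ℕ) {t : ℝ} (ht : 0 ≤ t)
    (g : E →ₗ[ℝ] (Fin i → ℝ)) (hg : ∀ x, g x = 0 → ‖T x‖ ≤ t * ‖x‖) :
    T.singularValues i ≤ t := by
  by_cases hi : i < finrank ℝ E
  · refine le_of_sq_le_sq ?_ ht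
    refine le_of_diagonal_of_forall_eq_zero T.adjoint_comp_self_rightSingularBasis
      T.antitone_sq_singularValues ⟨i, hi⟩ g fun z hz => ?_
    rw [T.inner_adjoint_comp_self, ← mul_pow]
    exact pow_le_pow_left₀ (norm_nonneg _) (hg z hz) 2
  · rwa [T.singularValues_of_finrank_le (not_lt.1 hi)]

end LinearMap

end SingularValues

/-! ### The symmetric dilation of a linear map -/

section SymmetricDilation

variable {E F : Type*} [NormedAddCommGroup E] [InnerProductSpace ℝ E]
  [NormedAddCommGroup F] [InnerProductSpace ℝ F]

/-- The operator `(y, x) ↦ (A x, 0)` on `F × E` plus `c / 4` times the rank-one operator `w ⟨w, ·⟩`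
with `w = (u, v)`. It is not symmetric; `dilation` is its sum with its adjoint. -/
noncomputable def halfDilation (A : E →ₗ[ℝ] F) (c : ℝ) (u : F) (v : E) :
    WithLp 2 (F × E) →ₗ[ℝ] WithLp 2 (F × E) :=
  (WithLp.linearEquiv 2 ℝ (F × E)).symm.toLinearMap ∘ₗ LinearMap.inl ℝ F E ∘ₗ A ∘ₗ
      LinearMap.snd ℝ F E ∘ₗ (WithLp.linearEquiv 2 ℝ (F × E)).toLinearMap +
    (c / 4) • (innerSL ℝ (WithLp.toLp 2 (u, v))).toLinearMap.smulRight (WithLp.toLp 2 (u, v))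

theorem inner_halfDilation (A : E →ₗ[ℝ] F) (c : ℝ) (u : F) (v : E) (z : WithLp 2 (F × E)) :
    inner ℝ z (halfDilation A c u v z) =
      inner ℝ z.fst (A z.snd) + c / 4 * (inner ℝ u z.fst + inner ℝ v z.snd) ^ 2 := by
  simp only [halfDilation, LinearMap.add_apply, inner_add_right, LinearMap.comp_apply,
    LinearMap.smul_apply, LinearMap.smulRight_apply, inner_smul_right]
  rw [WithLp.prod_inner_apply, real_inner_comm, WithLp.prod_inner_apply]
  simp [WithLp.prod_inner_apply]
  rw [real_inner_comm z.fst u, real_inner_comm z.snd v, real_inner_comm z.fst (A z.snd)]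
  ring

variable [FiniteDimensional ℝ E] [FiniteDimensional ℝ F]

/-- The symmetric operator on `F × E` with quadratic form `2 ⟨y, A x⟩ + (c / 2) (⟨u, y⟩ + ⟨v, x⟩)²`.
For `c ≥ 0` it dominates the dilations `2 ⟨y, A x⟩` and `2 ⟨y, B x⟩` of both `A` and its rank-one
perturbation `B = A + c u ⟨v, ·⟩`. -/
noncomputable def dilation (A : E →ₗ[ℝ] F) (c : ℝ) (u : F) (v : E) :
    WithLp 2 (F × E) →ₗ[ℝ] WithLp 2 (F × E) :=
  halfDilation A c u v + (halfDilation A c u v).adjoint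

theorem isSymmetric_dilation (A : E →ₗ[ℝ] F) (c : ℝ) (u : F) (v : E) :
    (dilation A c u v).IsSymmetric := by
  intro x y
  simp only [dilation, LinearMap.add_apply, inner_add_left, inner_add_right,
    LinearMap.adjoint_inner_left, LinearMap.adjoint_inner_right]
  ring

theorem inner_dilation (A : E →ₗ[ℝ] F) (c : ℝ) (u : F) (v : E) (z : WithLp 2 (F × E)) :
    inner ℝ z (dilation A c u v z) =
      2 * inner ℝ z.fst (A z.snd) + c / 2 * (inner ℝ u z.fst + inner ℝ v z.snd) ^ 2 := by
  rw [dilation, LinearMap.add_apply, inner_add_right, LinearMap.adjoint_inner_right,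
    real_inner_comm z (halfDilation A c u v z), inner_halfDilation]
  ring

theorem trace_dilation_le (A : E →ₗ[ℝ] F) {c : ℝ} (hc : 0 ≤ c) {u : F} {v : E} (hu : ‖u‖ ≤ 1)
    (hv : ‖v‖ ≤ 1) : LinearMap.trace ℝ _ (dilation A c u v) ≤ c := by
  rw [LinearMap.trace_eq_sum_inner _
    ((stdOrthonormalBasis ℝ F).prod (stdOrthonormalBasis ℝ E)), Fintype.sum_sum_type]
  simp only [inner_dilation]
  simp only [OrthonormalBasis.prod_apply, Sum.elim_inl, Sum.elim_inr]
  simp [← Finset.mul_sum]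
  have h1 := (stdOrthonormalBasis ℝ F).sum_inner_sq u
  have h2 := (stdOrthonormalBasis ℝ E).sum_inner_sq v
  simp only [real_inner_comm] at h1 h2
  rw [h1, h2]
  have : ‖u‖ ^ 2 ≤ 1 := pow_le_one₀ (norm_nonneg _) hu
  have : ‖v‖ ^ 2 ≤ 1 := pow_le_one₀ (norm_nonneg _) hv
  nlinarith

variable {N : ℕ} {e : OrthonormalBasis (Fin N) ℝ (WithLp 2 (F × E))}
  {T : WithLp 2 (F × E) →ₗ[ℝ] WithLp 2 (F × E)} {h : Fin N → ℝ}

/-- If a quadratic form dominates the dilation of `C`, its eigenvalues dominate the singular values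
of `C`. The test subspace is spanned by the paired left and right singular vectors, or, where the
singular value vanishes, it is the second factor. -/
theorem singularValues_le_of_diagonal (hT : ∀ j, T (e j) = h j • e j) (hh : Antitone h)
    {C : E →ₗ[ℝ] F} (hC : ∀ z, 2 * inner ℝ z.fst (C z.snd) ≤ inner ℝ z (T z)) (i : Fin N)
    (hi : (i : ℕ) < finrank ℝ E) : C.singularValues i ≤ h i := by
  rcases (C.singularValues_nonneg i).eq_or_lt with h0 | hpos
  · rw [← h0]
    let f : E →ₗ[ℝ] WithLp 2 (F × E) :=
      (WithLp.linearEquiv 2 ℝ (F × E)).symm.toLinearMap ∘ₗ LinearMap.inr ℝ F E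
    have hf : Function.Injective f :=
      (WithLp.linearEquiv 2 ℝ (F × E)).symm.injective.comp LinearMap.inr_injective
    refine le_of_diagonal_of_forall_mem hT hh i (LinearMap.range f)
      (by rwa [LinearMap.finrank_range_of_inj hf]) ?_
    rintro _ ⟨x, rfl⟩
    refine le_trans ?_ (hC (f x))
    simp [f]
  · let v : Fin ((i : ℕ) + 1) → E := fun j => C.rightSingularBasis (Fin.castLE hi j)
    let σ : Fin ((i : ℕ) + 1) → ℝ := fun j => C.singularValues j
    have hσi : ∀ j, C.singularValues i ≤ σ j := fun j =>
      C.singularValues_antitone (Nat.lt_succ_iff.1 j.2)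
    have hσ : ∀ j, 0 < σ j := fun j => hpos.trans_le (hσi j)
    have hCv : ∀ j k, inner ℝ (C (v j)) (C (v k)) = if j = k then σ k ^ 2 else 0 := fun j k => by
      rw [C.inner_apply_rightSingularBasis]
      simp [σ]
    have hvv : ∀ j k, inner ℝ (v j) (v k) = if j = k then (1 : ℝ) else 0 := fun j k => by
      rw [orthonormal_iff_ite.1 C.rightSingularBasis.orthonormal]
      simp
    let w : Fin ((i : ℕ) + 1) → WithLp 2 (F × E) := fun j =>
      WithLp.toLp 2 ((σ j)⁻¹ • C (v j), v j)
    have hw : LinearIndependent ℝ w := by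
      refine LinearIndependent.of_comp
        (LinearMap.snd ℝ F E ∘ₗ (WithLp.linearEquiv 2 ℝ (F × E)).toLinearMap) ?_
      exact C.rightSingularBasis.orthonormal.linearIndependent.comp _ (Fin.castLE_injective hi)
    refine le_of_diagonal_of_forall_mem hT hh i (Submodule.span ℝ (Set.range w))
      (by rw [finrank_span_eq_card hw]; simp) fun z hz => le_trans ?_ (hC z)
    obtain ⟨c, rfl⟩ := (Submodule.mem_span_range_iff_exists_fun ℝ).1 hz
    have hfst : (∑ j, c j • w j).fst = ∑ j, (c j * (σ j)⁻¹) • C (v j) := by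
      have := map_sum (LinearMap.fst ℝ F E ∘ₗ (WithLp.linearEquiv 2 ℝ (F × E)).toLinearMap)
        (fun j => c j • w j) Finset.univ
      refine this.trans (Finset.sum_congr rfl fun j _ => ?_)
      simp [w, smul_smul]
    have hsnd : (∑ j, c j • w j).snd = ∑ j, c j • v j := by
      have := map_sum (LinearMap.snd ℝ F E ∘ₗ (WithLp.linearEquiv 2 ℝ (F × E)).toLinearMap)
        (fun j => c j • w j) Finset.univ
      refine this.trans (Finset.sum_congr rfl fun j _ => ?_)
      simp [w]
    have h1 : inner ℝ (∑ j, c j • w j).fst (∑ j, c j • w j).fst = ∑ j, c j ^ 2 := by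
      rw [hfst]
      simp only [sum_inner, inner_sum, real_inner_smul_left, real_inner_smul_right, hCv]
      refine Finset.sum_congr rfl fun j _ => ?_
      have := (hσ j).ne'
      simp
      field_simp
    have h2 : inner ℝ (∑ j, c j • w j).snd (∑ j, c j • w j).snd = ∑ j, c j ^ 2 := by
      rw [hsnd]
      simp only [sum_inner, inner_sum, real_inner_smul_left, real_inner_smul_right, hvv]
      refine Finset.sum_congr rfl fun j _ => ?_
      simp [pow_two]
    have h3 : inner ℝ (∑ j, c j • w j).fst (C (∑ j, c j • w j).snd) = ∑ j, σ j * c j ^ 2 := by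
      rw [hfst, hsnd, map_sum]
      simp only [map_smul, sum_inner, inner_sum, real_inner_smul_left, real_inner_smul_right, hCv]
      refine Finset.sum_congr rfl fun j _ => ?_
      have := (hσ j).ne'
      simp
      field_simp
    rw [← real_inner_self_eq_norm_sq (∑ j, c j • w j), WithLp.prod_inner_apply]
    change _ * (inner ℝ (∑ j, c j • w j).fst (∑ j, c j • w j).fst +
      inner ℝ (∑ j, c j • w j).snd (∑ j, c j • w j).snd) ≤ _
    rw [h1, h2, h3, ← two_mul, mul_left_comm, Finset.mul_sum]
    exact mul_le_mul_of_nonneg_left (Finset.sum_le_sum fun j _ =>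
      mul_le_mul_of_nonneg_right (hσi j) (sq_nonneg _)) zero_le_two

/-- The negative of the dilation of `C` has the same spectrum, so the singular values of `C` also
dominate the reflected spectrum of a form that dominates the dilation. -/
theorem neg_rev_le_singularValues_of_diagonal (hT : ∀ j, T (e j) = h j • e j) (hh : Antitone h)
    {C : E →ₗ[ℝ] F} (hC : ∀ z, 2 * inner ℝ z.fst (C z.snd) ≤ inner ℝ z (T z)) (i : Fin N)
    (hi : (i : ℕ) < finrank ℝ E) : -h i.rev ≤ C.singularValues i := by
  refine neg_rev_le_of_diagonal_of_forall_eq_zero hT hh i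
    (innerFamily (fun j : Fin i => C.rightSingularBasis (Fin.castLE hi.le j)) ∘ₗ
      LinearMap.snd ℝ F E ∘ₗ (WithLp.linearEquiv 2 ℝ (F × E)).toLinearMap) fun z hz => ?_
  refine le_trans ?_ (hC z)
  rw [LinearMap.comp_apply, innerFamily_eq_zero] at hz
  have h1 : ‖C z.snd‖ ≤ C.singularValues i * ‖z.snd‖ :=
    C.norm_apply_le_singularValues i fun j hj => hz ⟨j, hj⟩
  have h2 := abs_le.1 (abs_real_inner_le_norm z.fst (C z.snd))
  have h3 : ‖z.fst‖ * ‖C z.snd‖ ≤ ‖z.fst‖ * (C.singularValues i * ‖z.snd‖) :=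
    mul_le_mul_of_nonneg_left h1 (norm_nonneg _)
  have h4 : C.singularValues i * (2 * ‖z.fst‖ * ‖z.snd‖) ≤
      C.singularValues i * (‖z.fst‖ ^ 2 + ‖z.snd‖ ^ 2) :=
    mul_le_mul_of_nonneg_left (two_mul_le_add_sq _ _) (C.singularValues_nonneg _)
  rw [WithLp.prod_norm_sq_eq_of_L2]
  nlinarith

/-- Changing the sign of the second component conjugates the dilation to an operator `H` such that
`-H` is below the dilation, so each eigenvalue and its mirror image have a nonnegative sum. -/
theorem neg_rev_le_of_dilation {A : E →ₗ[ℝ] F} {c : ℝ} (hc : 0 ≤ c) {u : F} {v : E}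
    (hT : ∀ j, dilation A c u v (e j) = h j • e j) (hh : Antitone h) (i : Fin N) :
    -h i.rev ≤ h i := by
  let J : WithLp 2 (F × E) →ₗ[ℝ] WithLp 2 (F × E) :=
    (WithLp.linearEquiv 2 ℝ (F × E)).symm.toLinearMap ∘ₗ
      (LinearMap.prodMap LinearMap.id (-LinearMap.id)) ∘ₗ
      (WithLp.linearEquiv 2 ℝ (F × E)).toLinearMap
  have hJf : ∀ z, (J z).fst = z.fst := fun z => rfl
  have hJs : ∀ z, (J z).snd = -z.snd := fun z => rfl
  refine neg_rev_le_of_diagonal_of_forall_eq_zero hT hh i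
    (innerFamily (fun j : Fin i => e (Fin.castLE i.2.le j)) ∘ₗ J) fun z hz => ?_
  rw [LinearMap.comp_apply, innerFamily_eq_zero] at hz
  have h1 : inner ℝ (J z) (dilation A c u v (J z)) ≤ h i * ‖J z‖ ^ 2 := by
    rw [inner_apply_eq_sum_of_diagonal hT, ← e.sum_inner_sq, Finset.mul_sum]
    refine Finset.sum_le_sum fun j _ => ?_
    rcases lt_or_ge j i with hj | hj
    · have h0 : inner ℝ (e j) (J z) = 0 := hz ⟨j, hj⟩
      simp [h0]
    · exact mul_le_mul_of_nonneg_right (hh hj) (sq_nonneg _)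
  have hn : ‖J z‖ ^ 2 = ‖z‖ ^ 2 := by
    rw [WithLp.prod_norm_sq_eq_of_L2, WithLp.prod_norm_sq_eq_of_L2, hJf, hJs, norm_neg]
  rw [hn, inner_dilation, hJf, hJs, map_neg, inner_neg_right, inner_neg_right] at h1
  rw [inner_dilation]
  have := mul_nonneg hc (sq_nonneg (inner ℝ u z.fst))
  have := mul_nonneg hc (sq_nonneg (inner ℝ v z.snd))
  nlinarith

end SymmetricDilation

/-! ### Concave functions on disjoint intervals -/

section Concave

theorem ConcaveOn.add_le_add_of_le {f : ℝ → ℝ} (hf : ConcaveOn ℝ (Set.Ici 0) f) {x y d : ℝ}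
    (hx : 0 ≤ x) (hxy : x ≤ y) (hd : 0 ≤ d) : f (y + d) + f x ≤ f (x + d) + f y := by
  rcases eq_or_lt_of_le (add_le_add hxy hd : x + 0 ≤ y + d) with h | h
  · have h1 : d = 0 := by linarith
    have h2 : x = y := by linarith
    simp [h1, h2]
  · have hpos : 0 < y + d - x := by linarith
    have hs0 : 0 ≤ (y - x) / (y + d - x) := div_nonneg (by linarith) hpos.le
    have hs1 : 0 ≤ d / (y + d - x) := div_nonneg hd hpos.le
    have hs : (y - x) / (y + d - x) + d / (y + d - x) = 1 := by
      rw [← add_div, div_eq_one_iff_eq hpos.ne']; ring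
    have hxm : x ∈ Set.Ici (0 : ℝ) := hx
    have hym : y + d ∈ Set.Ici (0 : ℝ) := by simp only [Set.mem_Ici]; linarith
    have h1 := hf.2 hxm hym hs0 hs1 hs
    have h2 := hf.2 hxm hym hs1 hs0 (by rw [add_comm]; exact hs)
    have e1 : ((y - x) / (y + d - x)) • x + (d / (y + d - x)) • (y + d) = x + d := by
      simp only [smul_eq_mul]; field_simp; ring
    have e2 : (d / (y + d - x)) • x + ((y - x) / (y + d - x)) • (y + d) = y := by
      simp only [smul_eq_mul]; field_simp; ring
    rw [e1] at h1
    rw [e2] at h2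
    simp only [smul_eq_mul] at h1 h2
    linear_combination h1 + h2 - (f x + f (y + d)) * hs

theorem sum_sub_le_of_interlaced {hi lo : ℕ → ℝ} (h0 : ∀ i, 0 ≤ lo i)
    (hint : ∀ i, hi (i + 1) ≤ lo i) (hle : ∀ i, lo i ≤ hi i) (N : ℕ) :
    ∑ i ∈ Finset.range N, (hi i - lo i) ≤ hi 0 := by
  suffices ∑ i ∈ Finset.range N, (hi i - lo i) ≤ hi 0 - hi N by
    linarith [h0 N, hle N]
  rw [← Finset.sum_range_sub']
  exact Finset.sum_le_sum fun i _ => by linarith [hint i]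

/-- The increments of a concave function over disjoint intervals add up to at most its increment
over an interval of the same total length starting at `0`. -/
theorem ConcaveOn.sum_sub_le_of_interlaced {f : ℝ → ℝ} (hf : ConcaveOn ℝ (Set.Ici 0) f) (N : ℕ) :
    ∀ {hi lo : ℕ → ℝ}, (∀ i, 0 ≤ lo i) → (∀ i, hi (i + 1) ≤ lo i) → (∀ i, lo i ≤ hi i) →
    ∑ i ∈ Finset.range N, (f (hi i) - f (lo i)) ≤
      f (∑ i ∈ Finset.range N, (hi i - lo i)) - f 0 := by
  induction N with
  | zero => simp
  | succ N ih =>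
    intro hi lo h0 hint hle
    rw [Finset.sum_range_succ', Finset.sum_range_succ']
    have h1 := ih (hi := fun i => hi (i + 1)) (lo := fun i => lo (i + 1)) (fun i => h0 _)
      (fun i => hint _) (fun i => hle _)
    have hL := _root_.sum_sub_le_of_interlaced (hi := fun i => hi (i + 1))
      (lo := fun i => lo (i + 1)) (fun i => h0 _) (fun i => hint _) (fun i => hle _) N
    have h2 := hf.add_le_add_of_le (d := hi 0 - lo 0)
      (Finset.sum_nonneg fun i (_ : i ∈ Finset.range N) => sub_nonneg.2 (hle (i + 1)))
      (hL.trans (hint 0)) (sub_nonneg.2 (hle 0))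
    rw [add_sub_cancel] at h2
    linarith

end Concave

/-! ### The perturbation inequality for powers of singular values -/

section Perturbation

variable {E F : Type*} [NormedAddCommGroup E] [InnerProductSpace ℝ E] [FiniteDimensional ℝ E]
  [NormedAddCommGroup F] [InnerProductSpace ℝ F] [FiniteDimensional ℝ F]

namespace LinearMap

theorem singularValues_succ_le_of_forall_orthogonal_eq {A B : E →ₗ[ℝ] F} {v : E}
    (hAB : ∀ x, inner ℝ v x = 0 → A x = B x) (i : ℕ) :
    A.singularValues (i + 1) ≤ B.singularValues i := by
  refine A.singularValues_le_of_forall_eq_zero _ (B.singularValues_nonneg i)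
    (innerFamily (Fin.cons v fun j : Fin i =>
      if h : (j : ℕ) < finrank ℝ E then B.rightSingularBasis ⟨j, h⟩ else 0)) fun x hx => ?_
  rw [innerFamily_eq_zero] at hx
  rw [hAB x (hx 0)]
  refine B.norm_apply_le_singularValues i fun j hj => ?_
  have := hx (Fin.succ ⟨j, hj⟩)
  rwa [Fin.cons_succ, dif_pos j.2] at this

/-- A rank-one perturbation of norm at most `c` moves the singular values by at most `c` in
total: both sequences lie between the top eigenvalues of the dilation and the reflected bottom
ones, and the gaps are bounded by the trace. -/
theorem sum_abs_singularValues_sub_le {A B : E →ₗ[ℝ] F} (hFE : finrank ℝ F ≤ finrank ℝ E)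
    {c : ℝ} (hc : 0 ≤ c) {u : F} {v : E} (hu : ‖u‖ ≤ 1) (hv : ‖v‖ ≤ 1)
    (hB : ∀ x, B x = A x + (c * inner ℝ v x) • u) :
    ∑ i ∈ Finset.range (finrank ℝ F), |A.singularValues i - B.singularValues i| ≤ c := by
  set m := finrank ℝ F with hm
  set n := finrank ℝ E with hn
  have hN : finrank ℝ (WithLp 2 (F × E)) = m + n := by
    rw [(WithLp.linearEquiv 2 ℝ (F × E)).finrank_eq, finrank_prod]
  have hsymm := isSymmetric_dilation A c u v
  set h := hsymm.eigenvalues hN with hh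
  have hT : ∀ j, dilation A c u v (hsymm.eigenvectorBasis hN j) =
    h j • hsymm.eigenvectorBasis hN j := fun j => hsymm.apply_eigenvectorBasis hN j
  have hanti : Antitone h := hsymm.eigenvalues_antitone hN
  have htr : ∑ i, h i ≤ c := by
    have := trace_dilation_le A hc hu hv
    rwa [hsymm.trace_eq_sum_eigenvalues hN] at this
  have hA : ∀ z : WithLp 2 (F × E),
      2 * inner ℝ z.fst (A z.snd) ≤ inner ℝ z (dilation A c u v z) := fun z => by
    rw [inner_dilation]
    have := mul_nonneg hc (sq_nonneg (inner ℝ u z.fst + inner ℝ v z.snd))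
    linarith
  have hB' : ∀ z : WithLp 2 (F × E),
      2 * inner ℝ z.fst (B z.snd) ≤ inner ℝ z (dilation A c u v z) := fun z => by
    rw [inner_dilation, hB, inner_add_right, inner_smul_right, real_inner_comm u z.fst]
    have := mul_nonneg hc (sq_nonneg (inner ℝ u z.fst - inner ℝ v z.snd))
    linarith
  let g : Fin (m + n) → ℝ := fun i => h i + h i.rev
  have hg0 : ∀ i, 0 ≤ g i := fun i => by
    have := neg_rev_le_of_dilation hc hT hanti i
    change 0 ≤ h i + h i.rev
    linarith
  have hgap : ∀ i : Fin m, |A.singularValues i - B.singularValues i| ≤ g (Fin.castAdd n i) := by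
    intro i
    have hi : ((Fin.castAdd n i : Fin (m + n)) : ℕ) < finrank ℝ E := by
      have := i.2
      simp only [Fin.val_castAdd]
      omega
    have h1 := singularValues_le_of_diagonal hT hanti hA _ hi
    have h2 := singularValues_le_of_diagonal hT hanti hB' _ hi
    have h3 := neg_rev_le_singularValues_of_diagonal hT hanti hA _ hi
    have h4 := neg_rev_le_singularValues_of_diagonal hT hanti hB' _ hi
    simp only [Fin.val_castAdd] at h1 h2 h3 h4
    change _ ≤ h _ + h _
    rw [abs_le]
    constructor <;> linarith
  have hsum : ∑ i, g i ≤ 2 * c := by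
    have hrev : ∑ i : Fin (m + n), h i.rev = ∑ i, h i := Equiv.sum_comp Fin.revPerm h
    change ∑ i, (h i + h i.rev) ≤ _
    rw [Finset.sum_add_distrib, hrev]
    linarith
  -- The bottom eigenvalues contribute the same gaps as the top ones.
  have hbot : ∑ i : Fin m, g (Fin.castAdd n i) ≤ ∑ j : Fin n, g (Fin.natAdd m j) := by
    let φ : Fin m ↪ Fin n := ⟨fun i => (Fin.castLE hFE i).rev,
      Fin.rev_injective.comp (Fin.castLE_injective hFE)⟩
    calc ∑ i : Fin m, g (Fin.castAdd n i) = ∑ i : Fin m, g (Fin.natAdd m (φ i)) := by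
          refine Finset.sum_congr rfl fun i _ => ?_
          have : Fin.natAdd m (φ i) = (Fin.castAdd n i).rev := by
            ext
            have := i.2
            simp [φ]
            omega
          rw [this]
          simp [g, add_comm]
      _ = ∑ j ∈ Finset.univ.map φ, g (Fin.natAdd m j) := by rw [Finset.sum_map]
      _ ≤ _ := Finset.sum_le_sum_of_subset_of_nonneg (Finset.subset_univ _) fun _ _ _ => hg0 _
  rw [Fin.sum_univ_add] at hsum
  rw [Finset.sum_range]
  have := Finset.sum_le_sum fun i (_ : i ∈ Finset.univ) => hgap i
  linarith

/-- By interlacing, the intervals between corresponding singular values are disjoint, so the bound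
on their total length turns into a bound for the concave function `t ↦ t ^ p`. -/
theorem sum_abs_rpow_singularValues_sub_le_of_rankOne {A : E →ₗ[ℝ] F}
    (hFE : finrank ℝ F ≤ finrank ℝ E) {p : ℝ} (hp0 : 0 < p) (hp1 : p ≤ 1) (u : F) {v : E}
    (hv : ‖v‖ ≤ 1) :
    ∑ i ∈ Finset.range (finrank ℝ F),
      |(A + (innerSL ℝ v).toLinearMap.smulRight u).singularValues i ^ p -
        A.singularValues i ^ p| ≤ ‖u‖ ^ p := by
  set B := A + (innerSL ℝ v).toLinearMap.smulRight u with hBdef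
  have hBx : ∀ x, B x = A x + inner ℝ v x • u := fun x => by simp [hBdef]
  have hsum : ∑ i ∈ Finset.range (finrank ℝ F), |A.singularValues i - B.singularValues i|
      ≤ ‖u‖ := by
    refine sum_abs_singularValues_sub_le hFE (norm_nonneg u) (u := ‖u‖⁻¹ • u) ?_ hv fun x => ?_
    · rw [norm_smul, norm_inv, norm_norm]
      exact inv_mul_le_one
    · rw [hBx]
      rcases eq_or_ne u 0 with rfl | hu
      · simp
      · have := norm_ne_zero_iff.2 hu
        rw [smul_smul]
        congr 2
        field_simp
  have hf : ConcaveOn ℝ (Set.Ici 0) fun t : ℝ => t ^ p := Real.concaveOn_rpow hp0.le hp1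
  have hAB : ∀ i, A.singularValues (i + 1) ≤ B.singularValues i :=
    singularValues_succ_le_of_forall_orthogonal_eq (v := v) fun x hx => by simp [hBx, hx]
  have hBA : ∀ i, B.singularValues (i + 1) ≤ A.singularValues i :=
    singularValues_succ_le_of_forall_orthogonal_eq (v := v) fun x hx => by simp [hBx, hx]
  have key := hf.sum_sub_le_of_interlaced (finrank ℝ F)
    (hi := fun i => max (A.singularValues i) (B.singularValues i))
    (lo := fun i => min (A.singularValues i) (B.singularValues i))
    (fun i => le_min (A.singularValues_nonneg i) (B.singularValues_nonneg i))
    (fun i => max_le (le_min (A.singularValues_antitone i.le_succ) (hAB i))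
      (le_min (hBA i) (B.singularValues_antitone i.le_succ)))
    (fun i => min_le_max)
  have e1 : ∀ i, |B.singularValues i ^ p - A.singularValues i ^ p| =
      max (A.singularValues i) (B.singularValues i) ^ p -
        min (A.singularValues i) (B.singularValues i) ^ p := fun i => by
    rcases le_total (A.singularValues i) (B.singularValues i) with h | h
    · rw [max_eq_right h, min_eq_left h, abs_of_nonneg (sub_nonneg.2
        (Real.rpow_le_rpow (A.singularValues_nonneg i) h hp0.le))]
    · rw [max_eq_left h, min_eq_right h, abs_of_nonpos (sub_nonpos.2
        (Real.rpow_le_rpow (B.singularValues_nonneg i) h hp0.le)), neg_sub]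
  simp only [max_sub_min_eq_abs', Real.zero_rpow hp0.ne', sub_zero] at key
  simp only [e1]
  exact key.trans (Real.rpow_le_rpow (Finset.sum_nonneg fun _ _ => abs_nonneg _) hsum hp0.le)

theorem sum_abs_rpow_singularValues_sub_le_of_sum_rankOne {ι : Type*} {A : E →ₗ[ℝ] F}
    (hFE : finrank ℝ F ≤ finrank ℝ E) {p : ℝ} (hp0 : 0 < p) (hp1 : p ≤ 1) (u : ι → F) {v : ι → E}
    (hv : ∀ j, ‖v j‖ ≤ 1) (s : Finset ι) :
    ∑ i ∈ Finset.range (finrank ℝ F),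
      |(A + ∑ j ∈ s, (innerSL ℝ (v j)).toLinearMap.smulRight (u j)).singularValues i ^ p -
        A.singularValues i ^ p| ≤ ∑ j ∈ s, ‖u j‖ ^ p := by
  classical
  induction s using Finset.induction_on with
  | empty => simp
  | insert a s ha ih =>
    rw [Finset.sum_insert ha, Finset.sum_insert ha, add_comm (LinearMap.smulRight _ _), ← add_assoc]
    refine le_trans ?_ (add_le_add (sum_abs_rpow_singularValues_sub_le_of_rankOne hFE hp0 hp1 (u a)
      (hv a) (A := A + ∑ j ∈ s, (innerSL ℝ (v j)).toLinearMap.smulRight (u j))) ih)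
    rw [← Finset.sum_add_distrib]
    exact Finset.sum_le_sum fun i _ => abs_sub_le _ _ _

/-- The singular value decomposition as a sum of rank-one maps. -/
theorem sum_rightSingularBasis_smulRight (T : E →ₗ[ℝ] F) :
    ∑ j, (innerSL ℝ (T.rightSingularBasis j)).toLinearMap.smulRight
      (T (T.rightSingularBasis j)) = T := by
  ext x
  conv_rhs => rw [← T.rightSingularBasis.sum_repr' x]
  simp

theorem singularValues_of_finrank_codomain_le (T : E →ₗ[ℝ] F) {i : ℕ} (hi : finrank ℝ F ≤ i) :
    T.singularValues i = 0 :=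
  T.singularValues_eq_zero_iff_le_finrank_range.2 ((Submodule.finrank_le _).trans hi)

/-- The perturbation inequality for powers of singular values: the singular values of `S` and `T`
are compared index by index. It follows from the rank-one case by adding the terms of the singular
value decomposition of `S - T` to `T` one at a time. -/
theorem sum_abs_rpow_singularValues_sub_le (hFE : finrank ℝ F ≤ finrank ℝ E) {p : ℝ}
    (hp0 : 0 < p) (hp1 : p ≤ 1) (S T : E →ₗ[ℝ] F) :
    ∑ i ∈ Finset.range (finrank ℝ F), |S.singularValues i ^ p - T.singularValues i ^ p| ≤
      ∑ i ∈ Finset.range (finrank ℝ F), (S - T).singularValues i ^ p := by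
  have h := sum_abs_rpow_singularValues_sub_le_of_sum_rankOne (A := T) hFE hp0 hp1
    (fun j => (S - T) ((S - T).rightSingularBasis j)) (v := (S - T).rightSingularBasis)
    (fun j => ((S - T).rightSingularBasis.orthonormal.1 j).le) Finset.univ
  rw [sum_rightSingularBasis_smulRight, add_sub_cancel] at h
  simp only [norm_apply_rightSingularBasis] at h
  rw [Fin.sum_univ_eq_sum_range (fun i => (S - T).singularValues i ^ p)] at h
  refine h.trans (Finset.sum_subset (Finset.range_mono hFE) fun i _ hi => ?_).ge
  rw [singularValues_of_finrank_codomain_le _ (by simpa using hi), Real.zero_rpow hp0.ne']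

end LinearMap

end Perturbation

/-! ### Scalar inequalities -/

section ScalarInequalities

/-- The function `x ^ r * (1 - x)` attains its maximum at `x = r / (r + 1)`; this is the weighted
arithmetic-geometric mean inequality for `x / r` and `1 - x`. -/
theorem Real.rpow_mul_one_sub_le {r x : ℝ} (hr : 0 < r) (hx0 : 0 ≤ x) (hx1 : x ≤ 1) :
    x ^ r * (1 - x) ≤ (r / (r + 1)) ^ r / (r + 1) := by
  have hr1 : 0 < r + 1 := by linarith
  have h := Real.geom_mean_le_arith_mean2_weighted (w₁ := r / (r + 1)) (w₂ := 1 / (r + 1))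
    (p₁ := x / r) (p₂ := 1 - x) (by positivity) (by positivity) (by positivity) (by linarith)
    (by field_simp)
  have e : r / (r + 1) * (x / r) + 1 / (r + 1) * (1 - x) = 1 / (r + 1) := by field_simp; ring
  rw [e] at h
  have h2 := Real.rpow_le_rpow (mul_nonneg (Real.rpow_nonneg (div_nonneg hx0 hr.le) _)
    (Real.rpow_nonneg (sub_nonneg.2 hx1) _)) h hr1.le
  rw [Real.mul_rpow (Real.rpow_nonneg (div_nonneg hx0 hr.le) _)
    (Real.rpow_nonneg (sub_nonneg.2 hx1) _), ← Real.rpow_mul (div_nonneg hx0 hr.le),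
    ← Real.rpow_mul (sub_nonneg.2 hx1), div_mul_cancel₀ _ hr1.ne', div_mul_cancel₀ _ hr1.ne',
    Real.rpow_one, Real.div_rpow hx0 hr.le, Real.div_rpow zero_le_one hr1.le, Real.one_rpow,
    Real.rpow_add hr1, Real.rpow_one] at h2
  rw [Real.div_rpow hr.le hr1.le, div_div]
  have hrr : 0 < r ^ r := Real.rpow_pos_of_pos hr r
  have := mul_le_mul_of_nonneg_left h2 hrr.le
  calc x ^ r * (1 - x) = r ^ r * (x ^ r / r ^ r * (1 - x)) := by field_simp
    _ ≤ _ := this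
    _ = _ := by ring

theorem Real.rpow_mul_one_sub_le_inv {r x : ℝ} (hr : 0 < r) (hx0 : 0 ≤ x) (hx1 : x ≤ 1) :
    x ^ r * (1 - x) ≤ 1 / (r + 1) := by
  refine (Real.rpow_mul_one_sub_le hr hx0 hx1).trans ?_
  gcongr
  exact Real.rpow_le_one (by positivity) ((div_le_one (by linarith)).2 (by linarith)) hr.le

theorem Real.rpow_mul_one_sub_le_inv_two_mul {r x : ℝ} (hr : 1 ≤ r) (hx0 : 0 ≤ x) (hx1 : x ≤ 1) :
    x ^ r * (1 - x) ≤ 1 / (2 * (r + 1)) := by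
  have hr0 : 0 < r := by linarith
  refine (Real.rpow_mul_one_sub_le hr0 hx0 hx1).trans ?_
  have h2 : 2 ≤ ((r + 1) / r) ^ r := by
    have := one_add_mul_self_le_rpow_one_add (s := 1 / r)
      (by have : 0 < 1 / r := by positivity
          linarith) hr
    have e : 1 + 1 / r = (r + 1) / r := by field_simp
    rw [e, mul_one_div_cancel hr0.ne'] at this
    linarith
  have h3 : (r / (r + 1)) ^ r ≤ 1 / 2 := by
    rw [← inv_div, Real.inv_rpow (by positivity), one_div]
    exact inv_anti₀ two_pos h2
  calc (r / (r + 1)) ^ r / (r + 1) ≤ (1 / 2) / (r + 1) := by gcongr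
    _ = _ := by rw [div_div]

/-- The linear relation between `p` and the isometry constant leaves room for the tail bounds. -/
theorem tail_bound_lt {p α f : ℝ} (hp0 : 0 < p) (hp1 : p < 1) (hα0 : 0 < α)
    (hα : p < 1.0873 * (1 - α)) (hf1 : f ≤ 1) (hf : p < 2 / 3 → f ≤ p / (2 * (1 - p))) :
    α * f + p / 4 < 1 - α := by
  -- `0.9197 < 1 / 1.0873`.
  have hc : α < 1 - 0.9197 * p := by norm_num at hα ⊢; linarith
  rcases lt_or_ge p (2 / 3) with hp | hp
  · have h1 : 0 < 2 * (1 - p) := by linarith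
    have h2 : α * f ≤ α * (p / (2 * (1 - p))) := mul_le_mul_of_nonneg_left (hf hp) hα0.le
    have h3 : α * (p / (2 * (1 - p))) + α < 1 - p / 4 := by
      have e : α * (p / (2 * (1 - p))) + α = α * (2 - p) / (2 * (1 - p)) := by
        rw [eq_div_iff h1.ne', add_mul, mul_assoc, div_mul_cancel₀ _ h1.ne']
        ring
      rw [e, div_lt_iff₀ h1]
      have := mul_lt_mul_of_pos_right hc (by linarith : 0 < 2 - p)
      norm_num at this ⊢
      nlinarith [mul_pos hp0 (by linarith : 0 < 2 / 3 - p)]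
    linarith
  · have := mul_le_mul_of_nonneg_left hf1 hα0.le
    norm_num at hc
    linarith

/-- Bounds for the sum of the norms `w j` of consecutive blocks of a decreasing sequence in terms of
the shares `σ j` of the blocks in the `p`-mass. The first comes from `√(σ j * σ (j + 1))` being at
most the mean of the two shares, the second from `σ j ^ (2 / p - 3) * (1 - σ j)` being at most
`p / (2 * (1 - p))`. -/
theorem sum_le_of_sq_le_rpow_mul {p D : ℝ} (hp0 : 0 < p) (hp1 : p < 1) (hD : 0 ≤ D) {σ w : ℕ → ℝ}
    (hσ : ∀ j, 0 ≤ σ j) (L : ℕ) (hsum : ∑ j ∈ Finset.range (L + 1), σ j ≤ 1)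
    (hw0 : ∀ j, 0 ≤ w j) (hw : ∀ j, w j ^ 2 ≤ D * (σ j ^ (2 / p - 1) * σ (j + 1))) :
    (∑ j ∈ Finset.range L, w j) ^ 2 ≤ D ∧
      (p < 2 / 3 → (∑ j ∈ Finset.range L, w j) ^ 2 ≤ D * (p / (2 * (1 - p)))) := by
  have h2p : 2 < 2 / p := by rw [lt_div_iff₀ hp0]; linarith
  have hσ1 : ∀ j < L + 1, σ j ≤ 1 := fun j hj =>
    (Finset.single_le_sum (fun i _ => hσ i) (Finset.mem_range.2 hj)).trans hsum
  have hσ2 : ∀ j < L, σ j + σ (j + 1) ≤ 1 := fun j hj => by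
    refine le_trans ?_ hsum
    have : ({j, j + 1} : Finset ℕ) ⊆ Finset.range (L + 1) := by
      intro i; simp; omega
    refine le_trans (le_of_eq ?_) (Finset.sum_le_sum_of_subset_of_nonneg this fun i _ _ => hσ i)
    rw [Finset.sum_pair (by omega)]
  have hL : ∑ j ∈ Finset.range L, σ j ≤ 1 := by
    rw [Finset.sum_range_succ] at hsum; linarith [hσ L]
  have hL' : ∑ j ∈ Finset.range L, σ (j + 1) ≤ 1 := by
    rw [Finset.sum_range_succ'] at hsum; linarith [hσ 0]
  have hs0 : 0 ≤ ∑ j ∈ Finset.range L, w j := Finset.sum_nonneg fun j _ => hw0 j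
  constructor
  · suffices ∑ j ∈ Finset.range L, w j ≤ √D by
      calc _ ≤ √D ^ 2 := pow_le_pow_left₀ hs0 this 2
        _ = D := Real.sq_sqrt hD
    have hj : ∀ j ∈ Finset.range L, w j ≤ √D * ((σ j + σ (j + 1)) / 2) := fun j hj => by
      have hj := Finset.mem_range.1 hj
      have hmean : 0 ≤ (σ j + σ (j + 1)) / 2 := by linarith [hσ j, hσ (j + 1)]
      refine le_of_sq_le_sq ((hw j).trans ?_) (mul_nonneg (Real.sqrt_nonneg _) hmean)
      rw [mul_pow, Real.sq_sqrt hD]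
      refine mul_le_mul_of_nonneg_left ?_ hD
      have h1 : σ j ^ (2 / p - 1) ≤ σ j := by
        conv_rhs => rw [← Real.rpow_one (σ j)]
        exact Real.rpow_le_rpow_of_exponent_ge_of_imp (hσ j) (hσ1 j (by omega)) (by linarith)
          (fun _ h => by linarith)
      nlinarith [mul_le_mul_of_nonneg_right h1 (hσ (j + 1)), sq_nonneg (σ j - σ (j + 1))]
    refine (Finset.sum_le_sum hj).trans ?_
    rw [← Finset.mul_sum, ← Finset.sum_div, Finset.sum_add_distrib]
    exact mul_le_of_le_one_right (Real.sqrt_nonneg _) (by linarith)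
  · intro hp
    have h1p : 0 < 2 * (1 - p) := by linarith
    have hr : 0 < 2 / p - 3 := by
      rw [sub_pos, lt_div_iff₀ hp0]; linarith
    have hC0 : 0 ≤ D * (p / (2 * (1 - p))) := by positivity
    suffices ∑ j ∈ Finset.range L, w j ≤ √(D * (p / (2 * (1 - p)))) by
      calc _ ≤ √(D * (p / (2 * (1 - p)))) ^ 2 := pow_le_pow_left₀ hs0 this 2
        _ = _ := Real.sq_sqrt hC0
    have hj : ∀ j ∈ Finset.range L, w j ≤ √(D * (p / (2 * (1 - p)))) * σ j := fun j hj => by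
      have hj := Finset.mem_range.1 hj
      refine le_of_sq_le_sq ((hw j).trans ?_) (mul_nonneg (Real.sqrt_nonneg _) (hσ j))
      rw [mul_pow, Real.sq_sqrt hC0, mul_assoc]
      refine mul_le_mul_of_nonneg_left ?_ hD
      have h1 := Real.rpow_mul_one_sub_le_inv hr (hσ j) (hσ1 j (by omega))
      have e1 : 1 / (2 / p - 3 + 1) = p / (2 * (1 - p)) := by
        have : 2 / p - 3 + 1 = 2 * (1 - p) / p := by field_simp; ring
        rw [this, one_div_div]
      rw [e1] at h1
      have e2 : σ j ^ (2 / p - 1) = σ j ^ (2 / p - 3) * σ j ^ 2 := by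
        rw [← Real.rpow_natCast, ← Real.rpow_add_of_nonneg (hσ j) hr.le (by norm_num)]
        congr 1
        push_cast
        ring
      calc σ j ^ (2 / p - 1) * σ (j + 1) = (σ j ^ (2 / p - 3) * σ (j + 1)) * σ j ^ 2 := by
            rw [e2]; ring
        _ ≤ (σ j ^ (2 / p - 3) * (1 - σ j)) * σ j ^ 2 := by
            refine mul_le_mul_of_nonneg_right (mul_le_mul_of_nonneg_left ?_
              (Real.rpow_nonneg (hσ j) _)) (sq_nonneg _)
            linarith [hσ2 j hj]
        _ ≤ _ := mul_le_mul_of_nonneg_right h1 (sq_nonneg _)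
    refine (Finset.sum_le_sum hj).trans ?_
    rw [← Finset.mul_sum]
    exact mul_le_of_le_one_right (Real.sqrt_nonneg _) hL

end ScalarInequalities

/-! ### Blocks of a decreasing sequence -/

section Blocks

/-- The `j`-th of the consecutive blocks of length `M` that follow the first `k` indices. -/
def tailBlock (k M j : ℕ) : Finset ℕ := Finset.Ico (k + j * M) (k + (j + 1) * M)

theorem card_tailBlock (k M j : ℕ) : (tailBlock k M j).card = M := by
  rw [tailBlock, Nat.card_Ico, add_mul]; omega

theorem sum_range_eq_add_sum_tailBlock {W : Type*} [AddCommMonoid W] (f : ℕ → W) (k M L : ℕ) :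
    ∑ i ∈ Finset.range (k + L * M), f i =
      ∑ i ∈ Finset.range k, f i + ∑ j ∈ Finset.range L, ∑ i ∈ tailBlock k M j, f i := by
  induction L with
  | zero => simp
  | succ L ih =>
    rw [Finset.sum_range_succ, ← add_assoc, ← ih, tailBlock,
      Finset.sum_range_add_sum_Ico _ (by gcongr; omega)]

theorem disjoint_tailBlock (k M : ℕ) {i j : ℕ} (hij : i ≠ j) :
    Disjoint (tailBlock k M i) (tailBlock k M j) := by
  wlog h : i < j generalizing i j
  · exact (this hij.symm (by omega)).symm
  exact Finset.Ico_disjoint_Ico_consecutive _ _ _ |>.mono_right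
    (Finset.Ico_subset_Ico (by gcongr; omega) le_rfl)

theorem sum_tailBlock_le_sum_Ico {f : ℕ → ℝ} (hf : ∀ i, 0 ≤ f i) {N : ℕ}
    (hN : ∀ i, N ≤ i → f i = 0) (k M L : ℕ) :
    ∑ j ∈ Finset.range L, ∑ i ∈ tailBlock k M j, f i ≤ ∑ i ∈ Finset.Ico k N, f i := by
  have h1 := sum_range_eq_add_sum_tailBlock f k M L
  rw [← Finset.sum_range_add_sum_Ico f (Nat.le_add_right k (L * M))] at h1
  rw [← add_left_cancel h1]
  calc ∑ i ∈ Finset.Ico k (k + L * M), f i ≤ ∑ i ∈ Finset.Ico k (max (k + L * M) N), f i :=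
        Finset.sum_le_sum_of_subset_of_nonneg (Finset.Ico_subset_Ico_right (le_max_left _ _))
          fun i _ _ => hf i
    _ = ∑ i ∈ Finset.Ico k N, f i := by
        refine (Finset.sum_subset (Finset.Ico_subset_Ico_right (le_max_right _ _))
          fun i hi hi' => hN i ?_).symm
        simp only [Finset.mem_Ico] at hi hi'
        omega

/-- For a sequence with vanishing sum, the head and the first block together cancel the remaining
blocks. -/
theorem sum_range_add_eq_neg_sum_tailBlock {W : Type*} [AddCommGroup W] {y : ℕ → W} {k M N : ℕ}
    (hM : 0 < M) (hyN : ∀ i, N ≤ i → y i = 0) (hy : ∑ i ∈ Finset.range N, y i = 0) :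
    ∑ i ∈ Finset.range (k + M), y i =
      -∑ j ∈ Finset.range N, ∑ i ∈ tailBlock k M (j + 1), y i := by
  have h1 := sum_range_eq_add_sum_tailBlock y k M (N + 1)
  rw [Finset.sum_range_succ', add_comm (∑ j ∈ Finset.range N, _), ← add_assoc] at h1
  have h2 := sum_range_eq_add_sum_tailBlock y k M 1
  rw [Finset.sum_range_one, one_mul] at h2
  rw [← h2] at h1
  rw [eq_neg_iff_add_eq_zero]
  refine h1.symm.trans ?_
  rw [← hy]
  refine (Finset.sum_subset (Finset.range_mono (by nlinarith)) fun i _ hi => ?_).symm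
  exact hyN i (by simpa using hi)

variable {h : ℕ → ℝ} {p : ℝ}

/-- An entry of a block is at most the `p`-mean of the previous block. -/
theorem rpow_le_of_mem_tailBlock_succ (hh : Antitone h) (h0 : ∀ i, 0 ≤ h i) (hp0 : 0 < p)
    {k M : ℕ} (hM : 0 < M) {i j : ℕ} (hi : i ∈ tailBlock k M (j + 1)) :
    h i ^ p ≤ (∑ a ∈ tailBlock k M j, h a ^ p) / M := by
  rw [le_div_iff₀ (by exact_mod_cast hM), mul_comm, ← nsmul_eq_mul]
  conv_lhs => rw [← card_tailBlock k M j]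
  refine Finset.card_nsmul_le_sum _ _ _ fun a ha => ?_
  refine Real.rpow_le_rpow (h0 i) (hh ?_) hp0.le
  simp only [tailBlock, Finset.mem_Ico] at hi ha
  omega

theorem sq_le_of_rpow_le {x t : ℝ} (hx : 0 ≤ x) (hp0 : 0 < p) (hp2 : p ≤ 2) (ht : x ^ p ≤ t) :
    x ^ 2 ≤ t ^ (2 / p - 1) * x ^ p := by
  have h1 : (0 : ℝ) ≤ 2 / p - 1 := by rw [sub_nonneg, le_div_iff₀ hp0]; linarith
  have e : x ^ 2 = (x ^ p) ^ (2 / p - 1) * x ^ p := by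
    rw [← Real.rpow_mul hx, ← Real.rpow_add_of_nonneg hx (mul_nonneg hp0.le h1) hp0.le,
      ← Real.rpow_natCast]
    congr 1
    field_simp
    push_cast
    ring
  rw [e]
  exact mul_le_mul_of_nonneg_right (Real.rpow_le_rpow (Real.rpow_nonneg hx _) ht h1)
    (Real.rpow_nonneg hx _)

/-- The power mean inequality between exponents `p` and `2`. -/
theorem card_mul_rpow_mean_le_sum_sq (h0 : ∀ i, 0 ≤ h i) (hp0 : 0 < p) (hp2 : p ≤ 2) {k : ℕ}
    (hk : 0 < k) :
    k * ((∑ i ∈ Finset.range k, h i ^ p) / k) ^ (2 / p) ≤ ∑ i ∈ Finset.range k, h i ^ 2 := by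
  have hk' : (0 : ℝ) < k := by exact_mod_cast hk
  have h1 : (1 : ℝ) ≤ 2 / p := by rw [le_div_iff₀ hp0]; linarith
  have := Real.rpow_sum_le_const_mul_sum_rpow (Finset.range k) (fun i => h i ^ p) h1
  simp only [abs_of_nonneg (Real.rpow_nonneg (h0 _) p), Finset.card_range] at this
  have e : ∀ i, (h i ^ p) ^ (2 / p) = h i ^ 2 := fun i => by
    rw [← Real.rpow_mul (h0 i), mul_div_cancel₀ _ hp0.ne']; norm_cast
  simp only [e] at this
  rw [Real.div_rpow (Finset.sum_nonneg fun i _ => Real.rpow_nonneg (h0 i) p) hk'.le]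
  rw [Real.rpow_sub hk', Real.rpow_one] at this
  have hkp : 0 < (k : ℝ) ^ (2 / p) := Real.rpow_pos_of_pos hk' _
  calc _ = (k / (k : ℝ) ^ (2 / p)) * (∑ i ∈ Finset.range k, h i ^ p) ^ (2 / p) := by ring
    _ ≤ (k / (k : ℝ) ^ (2 / p)) * ((k : ℝ) ^ (2 / p) / k * ∑ i ∈ Finset.range k, h i ^ 2) :=
      mul_le_mul_of_nonneg_left this (by positivity)
    _ = _ := by field_simp

end Blocks

/-! ### The null space property for sequences -/

section NullSpaceProperty

variable {h : ℕ → ℝ} {p : ℝ}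

section InnerProduct

variable {W : Type*} [NormedAddCommGroup W] [InnerProductSpace ℝ W] {y : ℕ → W} {α : ℝ} {r : ℕ}

/-- The restricted isometry property for combinations `∑ c i • y i` of at most `r` of the vectors
`y i`, where `y i` is the image of a vector of norm `h i` and these vectors are orthogonal, so that
the squared norm of the combination is `∑ (c i * h i) ^ 2`. -/
def VectorRIP (h : ℕ → ℝ) (y : ℕ → W) (r : ℕ) (α : ℝ) : Prop :=
  ∀ (J : Finset ℕ) (c : ℕ → ℝ), J.card ≤ r →
    (1 - α) * ∑ i ∈ J, (c i * h i) ^ 2 ≤ ‖∑ i ∈ J, c i • y i‖ ^ 2 ∧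
      ‖∑ i ∈ J, c i • y i‖ ^ 2 ≤ (1 + α) * ∑ i ∈ J, (c i * h i) ^ 2

theorem VectorRIP.norm_sq_sum (H : VectorRIP h y r α) {J : Finset ℕ} (hJ : J.card ≤ r) :
    (1 - α) * ∑ i ∈ J, h i ^ 2 ≤ ‖∑ i ∈ J, y i‖ ^ 2 ∧
      ‖∑ i ∈ J, y i‖ ^ 2 ≤ (1 + α) * ∑ i ∈ J, h i ^ 2 := by
  simpa using H J (fun _ => 1) hJ

/-- Images of vectors with disjoint supports are nearly orthogonal, by polarization. -/
theorem VectorRIP.inner_sum_le (H : VectorRIP h y r α) {I J : Finset ℕ} (hIJ : Disjoint I J)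
    (hcard : I.card + J.card ≤ r) :
    inner ℝ (∑ i ∈ I, y i) (∑ i ∈ J, y i) ≤
      α * (√(∑ i ∈ I, h i ^ 2) * √(∑ i ∈ J, h i ^ 2)) := by
  classical
  set a := √(∑ i ∈ I, h i ^ 2) with ha
  set b := √(∑ i ∈ J, h i ^ 2) with hb
  have ha2 : ∑ i ∈ I, h i ^ 2 = a ^ 2 :=
    (Real.sq_sqrt (Finset.sum_nonneg fun _ _ => sq_nonneg _)).symm
  have hb2 : ∑ i ∈ J, h i ^ 2 = b ^ 2 :=
    (Real.sq_sqrt (Finset.sum_nonneg fun _ _ => sq_nonneg _)).symm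
  set u := ∑ i ∈ I, y i with hu
  set v := ∑ i ∈ J, y i with hv
  have hIr := (H.norm_sq_sum (J := I) (by omega)).2
  have hJr := (H.norm_sq_sum (J := J) (by omega)).2
  rw [ha2] at hIr
  rw [hb2] at hJr
  -- The combinations `b • u ± a • v` come from vectors of equal norm.
  have key : ∀ s : ℝ, s ^ 2 = 1 → (1 - α) * (2 * (a ^ 2 * b ^ 2)) ≤ ‖b • u + (s * a) • v‖ ^ 2 ∧
      ‖b • u + (s * a) • v‖ ^ 2 ≤ (1 + α) * (2 * (a ^ 2 * b ^ 2)) := fun s hs => by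
    have h1 := H (I ∪ J) (fun i => if i ∈ I then b else s * a)
      ((Finset.card_union_le _ _).trans hcard)
    have hJI : ∀ i ∈ J, i ∉ I := fun i hi hi' => Finset.disjoint_left.1 hIJ hi' hi
    rw [Finset.sum_union hIJ, Finset.sum_union hIJ,
      Finset.sum_congr rfl (g := fun i => b ^ 2 * h i ^ 2) (fun i hi => by rw [if_pos hi, mul_pow]),
      Finset.sum_congr (s₁ := J) rfl (g := fun i => a ^ 2 * h i ^ 2)
        (fun i hi => by rw [if_neg (hJI i hi), mul_pow, mul_pow, hs, one_mul]),
      Finset.sum_congr rfl (g := fun i => b • y i) (fun i hi => by rw [if_pos hi]),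
      Finset.sum_congr (s₁ := J) rfl (g := fun i => (s * a) • y i)
        (fun i hi => by rw [if_neg (hJI i hi)]),
      ← Finset.mul_sum, ← Finset.mul_sum, ← Finset.smul_sum, ← Finset.smul_sum, ha2, hb2] at h1
    have e : b ^ 2 * a ^ 2 + a ^ 2 * b ^ 2 = 2 * (a ^ 2 * b ^ 2) := by ring
    rwa [e] at h1
  have h1 := (key 1 (by norm_num)).2
  have h2 := (key (-1) (by norm_num)).1
  rw [norm_add_sq_real, real_inner_smul_left, real_inner_smul_right, norm_smul, norm_smul] at h1 h2
  simp only [mul_pow, norm_mul, Real.norm_eq_abs, sq_abs, abs_neg, abs_one] at h1 h2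
  have h3 : (a * b) * inner ℝ u v ≤ (a * b) * (α * (a * b)) := by nlinarith
  rcases (mul_nonneg (Real.sqrt_nonneg _) (Real.sqrt_nonneg _) : 0 ≤ a * b).eq_or_lt with h0 | h0
  · rcases mul_eq_zero.1 h0.symm with h0' | h0'
    · have : u = 0 := by
        rw [h0'] at hIr
        have : ‖u‖ = 0 := by
          have := sq_nonneg ‖u‖
          exact pow_eq_zero_iff two_ne_zero |>.1 (by nlinarith)
        simpa using this
      simp [this, h0']
    · have : v = 0 := by
        rw [h0'] at hJr
        have : ‖v‖ = 0 := by
          have := sq_nonneg ‖v‖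
          exact pow_eq_zero_iff two_ne_zero |>.1 (by nlinarith)
        simpa using this
      simp [this, h0']
  · exact le_of_mul_le_mul_left h3 h0

theorem norm_sum_sq_le_of_inner_le {Y : ℕ → W} {w : ℕ → ℝ} (L : ℕ)
    (hY : ∀ j, ‖Y j‖ ^ 2 ≤ (1 + α) * w j ^ 2)
    (hYY : ∀ i j, i ≠ j → inner ℝ (Y i) (Y j) ≤ α * (w i * w j)) :
    ‖∑ j ∈ Finset.range L, Y j‖ ^ 2 ≤
      α * (∑ j ∈ Finset.range L, w j) ^ 2 + ∑ j ∈ Finset.range L, w j ^ 2 := by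
  have hij : ∀ i j, inner ℝ (Y i) (Y j) ≤ α * (w i * w j) + if i = j then w i ^ 2 else 0 :=
    fun i j => by
      split_ifs with hij
      · subst hij
        rw [real_inner_self_eq_norm_sq]
        linarith [hY i]
      · simpa using hYY i j hij
  rw [← real_inner_self_eq_norm_sq, sum_inner]
  simp only [inner_sum]
  refine (Finset.sum_le_sum fun i _ => Finset.sum_le_sum fun j _ => hij i j).trans (le_of_eq ?_)
  simp only [Finset.sum_add_distrib]
  rw [pow_two (∑ j ∈ Finset.range L, w j), Finset.sum_mul_sum, Finset.mul_sum]
  congr 1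
  · simp only [Finset.mul_sum]
  · refine Finset.sum_congr rfl fun i hi => ?_
    rw [Finset.sum_ite_eq, if_pos hi]

/-- The null space property: under the restricted isometry property, a decreasing sequence in the
kernel carries less `p`-mass on its first `k` entries than on the others. Otherwise the blocks that
follow the first `2 * k` entries would be too small for their image to cancel that of the first
`2 * k` entries. -/
theorem VectorRIP.sum_rpow_lt (hh : Antitone h) (h0 : ∀ i, 0 ≤ h i) (hpos : 0 < h 0)
    (hp0 : 0 < p) (hp1 : p < 1) {k N : ℕ} (hk : 1 ≤ k) (hα0 : 0 < α) (hα1 : α < 1)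
    (hα : p < 1.0873 * (1 - α)) (hN : ∀ i, N ≤ i → h i = 0) (hyN : ∀ i, N ≤ i → y i = 0)
    (hy : ∑ i ∈ Finset.range N, y i = 0) (H : VectorRIP h y (2 * k) α) :
    ∑ i ∈ Finset.range k, h i ^ p < ∑ i ∈ Finset.Ico k N, h i ^ p := by
  by_contra! hcon
  have hk0 : (0 : ℝ) < k := by exact_mod_cast hk
  have h2p : 2 < 2 / p := by rw [lt_div_iff₀ hp0]; linarith
  have hrp : ∀ i, 0 ≤ h i ^ p := fun i => Real.rpow_nonneg (h0 i) p
  have hNp : ∀ i, N ≤ i → h i ^ p = 0 := fun i hi => by rw [hN i hi, Real.zero_rpow hp0.ne']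
  set P := ∑ i ∈ Finset.range k, h i ^ p with hP
  set D := ∑ i ∈ Finset.range k, h i ^ 2 with hD
  have h0k : 0 ∈ Finset.range k := Finset.mem_range.2 hk
  have hP0 : 0 < P := Finset.sum_pos' (fun i _ => hrp i) ⟨0, h0k, Real.rpow_pos_of_pos hpos p⟩
  have hD0 : 0 < D := Finset.sum_pos' (fun i _ => sq_nonneg _) ⟨0, h0k, by positivity⟩
  let s : ℕ → ℝ := fun j => ∑ i ∈ tailBlock k k j, h i ^ p
  have hs0 : ∀ j, 0 ≤ s j := fun j => Finset.sum_nonneg fun i _ => hrp i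
  -- The shares of the blocks in the `p`-mass of the head, and the norms of the blocks but the first.
  let σ : ℕ → ℝ := fun j => s j / P
  let w : ℕ → ℝ := fun j => √(∑ i ∈ tailBlock k k (j + 1), h i ^ 2)
  have hw2 : ∀ j, w j ^ 2 = ∑ i ∈ tailBlock k k (j + 1), h i ^ 2 := fun j =>
    Real.sq_sqrt (Finset.sum_nonneg fun _ _ => sq_nonneg _)
  have hσ0 : ∀ j, 0 ≤ σ j := fun j => div_nonneg (hs0 j) hP0.le
  have hσsum : ∑ j ∈ Finset.range (N + 1), σ j ≤ 1 := by
    rw [← Finset.sum_div, div_le_one hP0]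
    exact (sum_tailBlock_le_sum_Ico hrp hNp k k (N + 1)).trans hcon
  have hmean : k * (P / k) ^ (2 / p) ≤ D := card_mul_rpow_mean_le_sum_sq h0 hp0 (by linarith) hk
  -- In terms of the shares, the mass of a block is `P * σ j`, and `k * (P / k) ^ (2 / p) ≤ D`.
  have hscale : ∀ j t, 0 ≤ t → (s j / k) ^ (2 / p - 1) * (P * t) ≤
      D * (σ j ^ (2 / p - 1) * t) := fun j t ht => by
    have e : s j / k = σ j * (P / k) := by
      simp only [σ]; field_simp
    have hPk : 0 < P / k := div_pos hP0 hk0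
    rw [e, Real.mul_rpow (hσ0 j) hPk.le]
    have e2 : (P / k) ^ (2 / p - 1) * P = k * (P / k) ^ (2 / p) := by
      rw [Real.rpow_sub hPk, Real.rpow_one]; field_simp
    calc σ j ^ (2 / p - 1) * (P / k) ^ (2 / p - 1) * (P * t)
        = ((P / k) ^ (2 / p - 1) * P) * (σ j ^ (2 / p - 1) * t) := by ring
      _ ≤ D * (σ j ^ (2 / p - 1) * t) := by
          rw [e2]
          exact mul_le_mul_of_nonneg_right hmean (mul_nonneg (Real.rpow_nonneg (hσ0 j) _) ht)
  have hw : ∀ j, w j ^ 2 ≤ D * (σ j ^ (2 / p - 1) * σ (j + 1)) := fun j => by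
    refine le_trans ?_ (hscale j (σ (j + 1)) (hσ0 _))
    have e : P * σ (j + 1) = s (j + 1) := mul_div_cancel₀ _ hP0.ne'
    rw [hw2, e, Finset.mul_sum]
    exact Finset.sum_le_sum fun i hi => sq_le_of_rpow_le (h0 i) hp0 (by linarith)
      (rpow_le_of_mem_tailBlock_succ hh h0 hp0 hk hi)
  have hσ01 : σ 0 ≤ 1 :=
    (Finset.single_le_sum (fun i _ => hσ0 i) (Finset.mem_range.2 N.succ_pos)).trans hσsum
  -- All entries involved are at most the `p`-mean of the first block.
  have hG : ∑ j ∈ Finset.range N, w j ^ 2 ≤ D * (p / 4) := by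
    have h1 : ∀ j ∈ Finset.range N, w j ^ 2 ≤ D * (σ 0 ^ (2 / p - 1) * σ (j + 1)) := fun j _ => by
      refine le_trans ?_ (hscale 0 (σ (j + 1)) (hσ0 _))
      have e : P * σ (j + 1) = s (j + 1) := mul_div_cancel₀ _ hP0.ne'
      rw [hw2, e, Finset.mul_sum]
      refine Finset.sum_le_sum fun i hi => sq_le_of_rpow_le (h0 i) hp0 (by linarith) ?_
      refine le_trans ?_ (rpow_le_of_mem_tailBlock_succ hh h0 hp0 hk (i := k + k) (j := 0) ?_)
      · refine Real.rpow_le_rpow (h0 i) (hh ?_) hp0.le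
        have := (Finset.mem_Ico.1 hi).1
        nlinarith
      · simp only [tailBlock, Finset.mem_Ico]
        constructor <;> nlinarith
    refine (Finset.sum_le_sum h1).trans ?_
    rw [← Finset.mul_sum, ← Finset.mul_sum]
    refine mul_le_mul_of_nonneg_left ?_ hD0.le
    have h2 : ∑ j ∈ Finset.range N, σ (j + 1) ≤ 1 - σ 0 := by
      rw [Finset.sum_range_succ'] at hσsum
      linarith
    refine (mul_le_mul_of_nonneg_left h2 (Real.rpow_nonneg (hσ0 0) _)).trans ?_
    refine (Real.rpow_mul_one_sub_le_inv_two_mul (by linarith) (hσ0 0) hσ01).trans (le_of_eq ?_)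
    field_simp
    ring
  obtain ⟨hF1, hF2⟩ := sum_le_of_sq_le_rpow_mul hp0 hp1 hD0.le hσ0 N hσsum
    (fun j => Real.sqrt_nonneg _) hw
  set S := ∑ j ∈ Finset.range N, w j with hS
  have hnum := tail_bound_lt (f := S ^ 2 / D) hp0 hp1 hα0 hα ((div_le_one hD0).2 hF1)
    (fun hp => (div_le_iff₀' hD0).2 (hF2 hp))
  let Y : ℕ → W := fun j => ∑ i ∈ tailBlock k k (j + 1), y i
  have hYle : ‖∑ j ∈ Finset.range N, Y j‖ ^ 2 ≤ α * S ^ 2 + ∑ j ∈ Finset.range N, w j ^ 2 := by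
    refine norm_sum_sq_le_of_inner_le N (fun j => ?_) fun i j hij => ?_
    · rw [hw2]
      exact (H.norm_sq_sum (by rw [card_tailBlock]; omega)).2
    · exact H.inner_sum_le (disjoint_tailBlock k k (by omega))
        (by rw [card_tailBlock, card_tailBlock]; omega)
  -- The head and the first block are cancelled by the other blocks, whose images are too small.
  have hhead : ∑ i ∈ Finset.range (2 * k), y i = -∑ j ∈ Finset.range N, Y j := by
    rw [two_mul]
    exact sum_range_add_eq_neg_sum_tailBlock hk hyN hy
  have hlow := (H.norm_sq_sum (J := Finset.range (2 * k)) (by simp)).1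
  rw [hhead, norm_neg] at hlow
  have hDle : D ≤ ∑ i ∈ Finset.range (2 * k), h i ^ 2 :=
    Finset.sum_le_sum_of_subset_of_nonneg (Finset.range_mono (by omega)) fun _ _ _ => sq_nonneg _
  have h3 : (1 - α) * D ≤ α * S ^ 2 + D * (p / 4) := by
    have := mul_le_mul_of_nonneg_left hDle (sub_nonneg.2 hα1.le)
    linarith
  have h4 := mul_lt_mul_of_pos_right hnum hD0
  rw [add_mul, mul_assoc, div_mul_cancel₀ _ hD0.ne'] at h4
  linarith

end InnerProduct

section PIsometry

variable {l : ℕ} {y : ℕ → EuclideanSpace ℝ (Fin l)}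

theorem sum_abs_rpow_sum_le (hp0 : 0 < p) (hp1 : p ≤ 1) {ι : Type*} (s : Finset ι)
    (Y : ι → EuclideanSpace ℝ (Fin l)) :
    ∑ i, |(∑ j ∈ s, Y j) i| ^ p ≤ ∑ j ∈ s, ∑ i, |Y j i| ^ p := by
  classical
  induction s using Finset.induction_on with
  | empty => simp [Real.zero_rpow hp0.ne']
  | insert a s ha ih =>
    rw [Finset.sum_insert ha, Finset.sum_insert ha]
    refine le_trans ?_ (add_le_add_right ih _)
    rw [← Finset.sum_add_distrib]
    refine Finset.sum_le_sum fun i _ => ?_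
    refine (Real.rpow_le_rpow (abs_nonneg _) (abs_add_le _ _) hp0.le).trans ?_
    exact Real.rpow_add_le_add_rpow (abs_nonneg _) (abs_nonneg _) hp0.le hp1

/-- The null space property from restricted `p`-isometry constants, for blocks of length `M` with
`M / k ≥ b ^ (2 / (2 - p))`. -/
theorem sum_rpow_lt_of_restricted_pIsometry (hh : Antitone h) (h0 : ∀ i, 0 ≤ h i) (hpos : 0 < h 0)
    (hp0 : 0 < p) (hp1 : p < 1) {k M N : ℕ} (hk : 1 ≤ k) {b β₁ β₂ : ℝ} (hb : 1 < b)
    (hM : b ^ (2 / (2 - p)) * k ≤ M) (hβ₁ : 0 < β₁) (hβ₂ : β₂ < 1)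
    (hβ : β₁ + b * β₂ < b - 1) (hN : ∀ i, N ≤ i → h i = 0) (hyN : ∀ i, N ≤ i → y i = 0)
    (hy : ∑ i ∈ Finset.range N, y i = 0)
    (H₁ : ∀ J : Finset ℕ, J.card ≤ M →
      ∑ i, |(∑ j ∈ J, y j) i| ^ p ≤ (1 + β₁) * (∑ j ∈ J, h j ^ 2) ^ (p / 2))
    (H₂ : ∀ J : Finset ℕ, J.card ≤ M + k →
      (1 - β₂) * (∑ j ∈ J, h j ^ 2) ^ (p / 2) ≤ ∑ i, |(∑ j ∈ J, y j) i| ^ p) :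
    ∑ i ∈ Finset.range k, h i ^ p < ∑ i ∈ Finset.Ico k N, h i ^ p := by
  by_contra! hcon
  have hk0 : (0 : ℝ) < k := by exact_mod_cast hk
  have hb0 : 0 < b := by linarith
  have hM0' : (0 : ℝ) < M := lt_of_lt_of_le (mul_pos (Real.rpow_pos_of_pos hb0 _) hk0) hM
  have hM0 : 0 < M := by exact_mod_cast hM0'
  have hrp : ∀ i, 0 ≤ h i ^ p := fun i => Real.rpow_nonneg (h0 i) p
  have hNp : ∀ i, N ≤ i → h i ^ p = 0 := fun i hi => by rw [hN i hi, Real.zero_rpow hp0.ne']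
  set P := ∑ i ∈ Finset.range k, h i ^ p with hP
  set D := ∑ i ∈ Finset.range k, h i ^ 2 with hD
  have h0k : 0 ∈ Finset.range k := Finset.mem_range.2 hk
  have hP0 : 0 < P := Finset.sum_pos' (fun i _ => hrp i) ⟨0, h0k, Real.rpow_pos_of_pos hpos p⟩
  have hD0 : 0 < D := Finset.sum_pos' (fun i _ => sq_nonneg _) ⟨0, h0k, by positivity⟩
  let s : ℕ → ℝ := fun j => ∑ i ∈ tailBlock k M j, h i ^ p
  have hs0 : ∀ j, 0 ≤ s j := fun j => Finset.sum_nonneg fun i _ => hrp i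
  have hssum : ∑ j ∈ Finset.range N, s j ≤ P :=
    (sum_tailBlock_le_sum_Ico hrp hNp k M N).trans hcon
  have hmean : k * (P / k) ^ (2 / p) ≤ D := card_mul_rpow_mean_le_sum_sq h0 hp0 (by linarith) hk
  have hblock : ∀ j, (∑ i ∈ tailBlock k M (j + 1), h i ^ 2) ^ (p / 2) ≤
      (M : ℝ) ^ (p / 2) * (s j / M) := fun j => by
    have hsM : 0 ≤ s j / M := div_nonneg (hs0 j) hM0'.le
    have h1 : ∑ i ∈ tailBlock k M (j + 1), h i ^ 2 ≤ M * (s j / M) ^ (2 / p) := by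
      have := Finset.sum_le_card_nsmul (tailBlock k M (j + 1)) (fun i => h i ^ 2)
        ((s j / M) ^ (2 / p)) fun i hi => by
          have h2 := Real.rpow_le_rpow (hrp i) (rpow_le_of_mem_tailBlock_succ hh h0 hp0 hM0 hi)
            (by positivity : 0 ≤ 2 / p)
          rw [← Real.rpow_mul (h0 i), mul_div_cancel₀ _ hp0.ne'] at h2
          exact_mod_cast h2
      rwa [card_tailBlock, nsmul_eq_mul] at this
    refine (Real.rpow_le_rpow (Finset.sum_nonneg fun _ _ => sq_nonneg _) h1
      (by positivity)).trans (le_of_eq ?_)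
    rw [Real.mul_rpow hM0'.le (Real.rpow_nonneg hsM _), ← Real.rpow_mul hsM,
      div_mul_div_cancel₀ hp0.ne', div_self two_ne_zero, Real.rpow_one]
  have hhead := sum_range_add_eq_neg_sum_tailBlock (k := k) hM0 hyN hy
  have hlow := H₂ (Finset.range (k + M)) (by simp [add_comm])
  have hup : ∑ i, |(∑ j ∈ Finset.range (k + M), y j) i| ^ p ≤
      (1 + β₁) * ((M : ℝ) ^ (p / 2) * (P / M)) := by
    rw [hhead]
    simp only [PiLp.neg_apply, abs_neg]
    refine (sum_abs_rpow_sum_le hp0 hp1.le _ _).trans ?_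
    refine (Finset.sum_le_sum fun j _ => (H₁ _ (card_tailBlock k M (j + 1)).le).trans
      (mul_le_mul_of_nonneg_left (hblock j) (by linarith))).trans ?_
    rw [← Finset.mul_sum, ← Finset.mul_sum, ← Finset.sum_div]
    gcongr
  have hDle : D ^ (p / 2) ≤ (∑ i ∈ Finset.range (k + M), h i ^ 2) ^ (p / 2) :=
    Real.rpow_le_rpow hD0.le (Finset.sum_le_sum_of_subset_of_nonneg
      (Finset.range_mono (by omega)) fun _ _ _ => sq_nonneg _) (by positivity)
  have hPD : (k : ℝ) ^ (p / 2) * (P / k) ≤ D ^ (p / 2) := by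
    have h1 := Real.rpow_le_rpow (by positivity) hmean (by positivity : 0 ≤ p / 2)
    rwa [Real.mul_rpow hk0.le (by positivity), ← Real.rpow_mul (by positivity),
      div_mul_div_cancel₀ hp0.ne', div_self two_ne_zero, Real.rpow_one] at h1
  -- The choice of `M` makes the ratio of the two power-mean constants at least `b`.
  have hbM : b * ((M : ℝ) ^ (p / 2) * (P / M)) ≤ (k : ℝ) ^ (p / 2) * (P / k) := by
    have h2p : 0 < 2 - p := by linarith
    have h1 : b ≤ ((M : ℝ) / k) ^ (1 - p / 2) := by
      have h2 := Real.rpow_le_rpow (Real.rpow_nonneg hb0.le _) ((le_div_iff₀ hk0).2 hM)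
        (by linarith : 0 ≤ 1 - p / 2)
      rw [← Real.rpow_mul hb0.le] at h2
      have e : 2 / (2 - p) * (1 - p / 2) = 1 := by field_simp
      rwa [e, Real.rpow_one] at h2
    rw [Real.div_rpow hM0'.le hk0.le, le_div_iff₀ (Real.rpow_pos_of_pos hk0 _),
      Real.rpow_sub hM0', Real.rpow_sub hk0, Real.rpow_one, Real.rpow_one] at h1
    have hMp : 0 < (M : ℝ) ^ (p / 2) := Real.rpow_pos_of_pos hM0' _
    have hkp : 0 < (k : ℝ) ^ (p / 2) := Real.rpow_pos_of_pos hk0 _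
    have h3 := mul_le_mul_of_nonneg_right h1
      (by positivity : 0 ≤ (M : ℝ) ^ (p / 2) * (k : ℝ) ^ (p / 2) * P / (M * k))
    calc _ = b * (k / (k : ℝ) ^ (p / 2)) *
          ((M : ℝ) ^ (p / 2) * (k : ℝ) ^ (p / 2) * P / (M * k)) := by field_simp
      _ ≤ _ := h3
      _ = _ := by field_simp
  have hfin : (1 - β₂) * D ^ (p / 2) * b ≤ (1 + β₁) * D ^ (p / 2) := by
    have h1 := mul_le_mul_of_nonneg_left hDle (by linarith : 0 ≤ 1 - β₂)
    have h2 := mul_le_mul_of_nonneg_right (h1.trans (hlow.trans hup)) hb0.le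
    have h3 := mul_le_mul_of_nonneg_left (hbM.trans hPD) (by linarith : 0 ≤ 1 + β₁)
    linarith
  have hDp : 0 < D ^ (p / 2) := Real.rpow_pos_of_pos hD0 _
  have := mul_lt_mul_of_pos_right hβ hDp
  linarith

end PIsometry

end NullSpaceProperty

/-! ### The terms of the singular value decomposition -/

section SingularComponents

variable {E F : Type*} [NormedAddCommGroup E] [InnerProductSpace ℝ E] [FiniteDimensional ℝ E]
  [NormedAddCommGroup F] [InnerProductSpace ℝ F] [FiniteDimensional ℝ F]

namespace LinearMap

/-- The sum of the squared norms of the images of an orthonormal basis does not depend on the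
basis: it is the trace of `adjoint T ∘ T`. -/
theorem sum_norm_sq_apply_orthonormalBasis {ι κ : Type*} [Fintype ι] [Fintype κ] (T : E →ₗ[ℝ] F)
    (b : OrthonormalBasis ι ℝ E) (b' : OrthonormalBasis κ ℝ E) :
    ∑ i, ‖T (b i)‖ ^ 2 = ∑ i, ‖T (b' i)‖ ^ 2 := by
  simp only [← inner_adjoint_comp_self, ← LinearMap.trace_eq_sum_inner]

/-- The `j`-th rank-one term of the singular value decomposition, zero for `j` beyond the dimension
of the domain. -/
noncomputable def singularComponent (T : E →ₗ[ℝ] F) (j : ℕ) : E →ₗ[ℝ] F :=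
  if hj : j < finrank ℝ E then
    (innerSL ℝ (T.rightSingularBasis ⟨j, hj⟩)).toLinearMap.smulRight
      (T (T.rightSingularBasis ⟨j, hj⟩))
  else 0

theorem singularComponent_of_finrank_le (T : E →ₗ[ℝ] F) {j : ℕ} (hj : finrank ℝ E ≤ j) :
    T.singularComponent j = 0 := dif_neg (not_lt.2 hj)

theorem sum_singularComponent (T : E →ₗ[ℝ] F) :
    ∑ j ∈ Finset.range (finrank ℝ E), T.singularComponent j = T := by
  conv_rhs => rw [← T.sum_rightSingularBasis_smulRight]
  rw [Finset.sum_range]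
  exact Finset.sum_congr rfl fun j _ => dif_pos j.2

theorem singularComponent_apply_rightSingularBasis (T : E →ₗ[ℝ] F) (j : ℕ)
    (i : Fin (finrank ℝ E)) : T.singularComponent j (T.rightSingularBasis i) =
      if j = i then T (T.rightSingularBasis i) else 0 := by
  rw [singularComponent]
  split_ifs with hj hji hji
  · subst hji
    simp
  · have : inner ℝ (T.rightSingularBasis ⟨j, hj⟩) (T.rightSingularBasis i) = 0 :=
      T.rightSingularBasis.orthonormal.2 fun h => hji (congrArg Fin.val h)
    simp [this]
  · exact absurd (hji ▸ i.2) hj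
  · rfl

theorem sum_norm_sq_sum_singularComponent (T : E →ₗ[ℝ] F) (J : Finset ℕ) (c : ℕ → ℝ) :
    ∑ i, ‖(∑ j ∈ J, c j • T.singularComponent j) (T.rightSingularBasis i)‖ ^ 2 =
      ∑ j ∈ J, (c j * T.singularValues j) ^ 2 := by
  have h1 : ∀ i : Fin (finrank ℝ E),
      ‖(∑ j ∈ J, c j • T.singularComponent j) (T.rightSingularBasis i)‖ ^ 2 =
        if (i : ℕ) ∈ J then (c i * T.singularValues i) ^ 2 else 0 := fun i => by
    have : (∑ j ∈ J, c j • T.singularComponent j) (T.rightSingularBasis i) =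
        if (i : ℕ) ∈ J then c i • T (T.rightSingularBasis i) else 0 := by
      simp [LinearMap.sum_apply, singularComponent_apply_rightSingularBasis]
    rw [this]
    split_ifs
    · rw [norm_smul, norm_apply_rightSingularBasis, mul_pow, mul_pow, Real.norm_eq_abs, sq_abs]
    · simp
  simp only [h1]
  rw [Fin.sum_univ_eq_sum_range (fun i => if i ∈ J then (c i * T.singularValues i) ^ 2 else 0),
    ← Finset.sum_filter]
  refine Finset.sum_subset (fun i hi => (Finset.mem_filter.1 hi).2) fun i hiJ hi => ?_
  rw [T.singularValues_of_finrank_le, mul_zero, zero_pow two_ne_zero]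
  by_contra! hlt
  exact hi (Finset.mem_filter.2 ⟨Finset.mem_range.2 hlt, hiJ⟩)

theorem finrank_range_sum_singularComponent_le (T : E →ₗ[ℝ] F) (J : Finset ℕ) (c : ℕ → ℝ) :
    finrank ℝ (LinearMap.range (∑ j ∈ J, c j • T.singularComponent j)) ≤ J.card := by
  classical
  let w : ℕ → F := fun j => if hj : j < finrank ℝ E then T (T.rightSingularBasis ⟨j, hj⟩) else 0
  have hle : LinearMap.range (∑ j ∈ J, c j • T.singularComponent j) ≤
      Submodule.span ℝ (J.image w : Set F) := by
    rintro _ ⟨x, rfl⟩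
    rw [LinearMap.sum_apply]
    refine Submodule.sum_mem _ fun j hj => Submodule.smul_mem _ _ ?_
    by_cases hjn : j < finrank ℝ E
    · have hw : w j ∈ Submodule.span ℝ (J.image w : Set F) :=
        Submodule.subset_span (Finset.mem_coe.2 (Finset.mem_image_of_mem w hj))
      simp only [w, dif_pos hjn] at hw
      rw [singularComponent, dif_pos hjn]
      exact Submodule.smul_mem _ _ hw
    · rw [singularComponent, dif_neg hjn]
      exact Submodule.zero_mem _
  exact (Submodule.finrank_mono hle).trans
    ((finrank_span_finset_le_card _).trans Finset.card_image_le)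

end LinearMap

end SingularComponents

/-! ### Recovery of matrices -/

namespace SchattenRecovery

variable {m n l : ℕ}

theorem rank_eq_finrank_range_toEuclideanLin (X : Matrix (Fin m) (Fin n) ℝ) :
    X.rank = finrank ℝ (LinearMap.range (Matrix.toEuclideanLin X)) := by
  rw [Matrix.toEuclideanLin, Matrix.toLpLin_eq_toLin]
  exact X.rank_eq_finrank_range_toLin _ _

theorem frobeniusNorm_nonneg (X : Matrix (Fin m) (Fin n) ℝ) : 0 ≤ frobeniusNorm X := by
  rw [frobeniusNorm, Matrix.frobenius_norm_def]
  positivity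

theorem frobeniusNorm_sq (X : Matrix (Fin m) (Fin n) ℝ) {ι : Type*} [Fintype ι]
    (b : OrthonormalBasis ι ℝ (EuclideanSpace ℝ (Fin n))) :
    frobeniusNorm X ^ 2 = ∑ i, ‖Matrix.toEuclideanLin X (b i)‖ ^ 2 := by
  rw [LinearMap.sum_norm_sq_apply_orthonormalBasis _ b (EuclideanSpace.basisFun (Fin n) ℝ),
    frobeniusNorm, Matrix.frobenius_norm_def, ← Real.sqrt_eq_rpow,
    Real.sq_sqrt (by positivity), Finset.sum_comm]
  refine Finset.sum_congr rfl fun j _ => ?_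
  rw [EuclideanSpace.norm_sq_eq]
  refine Finset.sum_congr rfl fun i _ => ?_
  rw [EuclideanSpace.basisFun_apply, Matrix.ofLp_toLpLin, Matrix.toLin'_apply]
  simp

/-- The `j`-th rank-one term of the singular value decomposition of a matrix. -/
noncomputable def singularMatrix (Z : Matrix (Fin m) (Fin n) ℝ) (j : ℕ) : Matrix (Fin m) (Fin n) ℝ :=
  Matrix.toEuclideanLin.symm ((Matrix.toEuclideanLin Z).singularComponent j)

theorem toEuclideanLin_sum_singularMatrix (Z : Matrix (Fin m) (Fin n) ℝ) (J : Finset ℕ)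
    (c : ℕ → ℝ) : Matrix.toEuclideanLin (∑ j ∈ J, c j • singularMatrix Z j) =
      ∑ j ∈ J, c j • (Matrix.toEuclideanLin Z).singularComponent j := by
  simp [singularMatrix, map_sum]

theorem sum_singularMatrix (Z : Matrix (Fin m) (Fin n) ℝ) :
    ∑ j ∈ Finset.range n, singularMatrix Z j = Z := by
  apply Matrix.toEuclideanLin.injective
  have h1 := toEuclideanLin_sum_singularMatrix Z (Finset.range n) (fun _ => 1)
  simp only [one_smul] at h1
  rw [h1]
  conv_rhs => rw [← (Matrix.toEuclideanLin Z).sum_singularComponent, finrank_euclideanSpace_fin]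

theorem singularMatrix_of_le (Z : Matrix (Fin m) (Fin n) ℝ) {j : ℕ} (hj : n ≤ j) :
    singularMatrix Z j = 0 := by
  rw [singularMatrix, LinearMap.singularComponent_of_finrank_le _
    (by rwa [finrank_euclideanSpace_fin]), map_zero]

theorem frobeniusNorm_sum_singularMatrix_sq (Z : Matrix (Fin m) (Fin n) ℝ) (J : Finset ℕ)
    (c : ℕ → ℝ) : frobeniusNorm (∑ j ∈ J, c j • singularMatrix Z j) ^ 2 =
      ∑ j ∈ J, (c j * singularValue Z j) ^ 2 := by
  rw [frobeniusNorm_sq _ (Matrix.toEuclideanLin Z).rightSingularBasis,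
    toEuclideanLin_sum_singularMatrix, LinearMap.sum_norm_sq_sum_singularComponent]
  rfl

theorem rank_sum_singularMatrix_le (Z : Matrix (Fin m) (Fin n) ℝ) (J : Finset ℕ)
    (c : ℕ → ℝ) : (∑ j ∈ J, c j • singularMatrix Z j).rank ≤ J.card := by
  rw [rank_eq_finrank_range_toEuclideanLin, toEuclideanLin_sum_singularMatrix]
  exact LinearMap.finrank_range_sum_singularComponent_le _ _ _

theorem singularValue_nonneg (X : Matrix (Fin m) (Fin n) ℝ) (i : ℕ) : 0 ≤ singularValue X i :=
  LinearMap.singularValues_nonneg _ _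

theorem singularValue_antitone (X : Matrix (Fin m) (Fin n) ℝ) : Antitone (singularValue X) :=
  LinearMap.singularValues_antitone _

theorem singularValue_eq_zero_iff (X : Matrix (Fin m) (Fin n) ℝ) (i : ℕ) :
    singularValue X i = 0 ↔ X.rank ≤ i := by
  rw [rank_eq_finrank_range_toEuclideanLin]
  exact LinearMap.singularValues_eq_zero_iff_le_finrank_range _

theorem singularValue_zero_pos {X : Matrix (Fin m) (Fin n) ℝ} (hX : X ≠ 0) :
    0 < singularValue X 0 := by
  refine (singularValue_nonneg X 0).lt_of_ne' fun h => hX ?_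
  rw [singularValue_eq_zero_iff, Nat.le_zero, rank_eq_finrank_range_toEuclideanLin,
    Submodule.finrank_eq_zero, LinearMap.range_eq_bot] at h
  simpa using h

theorem schattenNorm_rpow {p : ℝ} (hp0 : 0 < p) (hmn : m ≤ n) (X : Matrix (Fin m) (Fin n) ℝ) :
    schattenNorm p X ^ p = ∑ i ∈ Finset.range m, singularValue X i ^ p := by
  rw [schattenNorm, min_eq_left hmn, ← Real.rpow_mul, one_div_mul_cancel hp0.ne', Real.rpow_one]
  exact Finset.sum_nonneg fun i _ => Real.rpow_nonneg (singularValue_nonneg X i) p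

theorem sum_abs_rpow_singularValue_sub_le {p : ℝ} (hp0 : 0 < p) (hp1 : p ≤ 1) (hmn : m ≤ n)
    (X Y : Matrix (Fin m) (Fin n) ℝ) :
    ∑ i ∈ Finset.range m, |singularValue X i ^ p - singularValue Y i ^ p| ≤
      ∑ i ∈ Finset.range m, singularValue (X - Y) i ^ p := by
  have := LinearMap.sum_abs_rpow_singularValues_sub_le (by simpa using hmn) hp0 hp1
    (Matrix.toEuclideanLin X) (Matrix.toEuclideanLin Y)
  rw [← map_sub, finrank_euclideanSpace_fin] at this
  exact this

/-- The null space property implies exact recovery: the perturbation inequality compares a matrix of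
rank at most `k` with an element of the kernel, index by index. -/
theorem exactlyRecovered_of_nullSpaceProperty
    {A : Matrix (Fin m) (Fin n) ℝ →ₗ[ℝ] EuclideanSpace ℝ (Fin l)} {p : ℝ} (hp0 : 0 < p)
    (hp1 : p ≤ 1) (hmn : m ≤ n) {k : ℕ}
    (hA : ∀ Z, A Z = 0 → Z ≠ 0 → ∑ i ∈ Finset.range k, singularValue Z i ^ p <
      ∑ i ∈ Finset.Ico k m, singularValue Z i ^ p)
    {Xbar : Matrix (Fin m) (Fin n) ℝ} (hX : Xbar.rank ≤ k) : ExactlyRecovered A p Xbar := by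
  have key : ∀ X, A X = A Xbar → X ≠ Xbar →
      schattenNorm p Xbar ^ p < schattenNorm p X ^ p := by
    intro X hAX hne
    rw [schattenNorm_rpow hp0 hmn, schattenNorm_rpow hp0 hmn]
    have hZ := hA (Xbar - X) (by rw [map_sub, hAX, sub_self]) (sub_ne_zero.2 hne.symm)
    have h1 := sum_abs_rpow_singularValue_sub_le hp0 hp1 hmn Xbar (Xbar - X)
    rw [sub_sub_cancel] at h1
    have hkm : k ≤ m := by
      by_contra! hlt
      rw [Finset.Ico_eq_empty_of_le hlt.le, Finset.sum_empty] at hZ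
      exact hZ.not_ge (Finset.sum_nonneg fun i _ => Real.rpow_nonneg (singularValue_nonneg _ i) p)
    have hzero : ∀ i ∈ Finset.Ico k m, singularValue Xbar i ^ p = 0 := fun i hi => by
      rw [(singularValue_eq_zero_iff Xbar i).2 (hX.trans (Finset.mem_Ico.1 hi).1),
        Real.zero_rpow hp0.ne']
    refine lt_of_lt_of_le ?_ h1
    rw [← Finset.sum_range_add_sum_Ico _ hkm, ← Finset.sum_range_add_sum_Ico _ hkm,
      Finset.sum_eq_zero hzero, add_zero]
    have h2 : ∑ i ∈ Finset.Ico k m, singularValue (Xbar - X) i ^ p ≤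
        ∑ i ∈ Finset.Ico k m, |singularValue Xbar i ^ p - singularValue (Xbar - X) i ^ p| :=
      Finset.sum_le_sum fun i hi => by
        rw [hzero i hi, zero_sub, abs_neg]
        exact le_abs_self _
    have h3 : ∑ i ∈ Finset.range k, (singularValue Xbar i ^ p - singularValue (Xbar - X) i ^ p) ≤
        ∑ i ∈ Finset.range k, |singularValue Xbar i ^ p - singularValue (Xbar - X) i ^ p| :=
      Finset.sum_le_sum fun i _ => le_abs_self _
    rw [Finset.sum_sub_distrib] at h3
    linarith
  have hfeas : ∀ X, ‖A X - A Xbar‖ ≤ 0 ↔ A X = A Xbar := fun X => by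
    rw [norm_le_zero_iff, sub_eq_zero]
  intro X
  constructor
  · rintro ⟨hf, hmin⟩
    by_contra hne
    exact (key X ((hfeas X).1 hf) hne).not_ge (hmin Xbar ((hfeas _).2 rfl))
  · rintro rfl
    refine ⟨(hfeas _).2 rfl, fun X' hX' => ?_⟩
    rcases eq_or_ne X' X with rfl | hne
    · exact le_rfl
    · exact (key X' ((hfeas X').1 hX') hne).le

section NullSpace

variable {A : Matrix (Fin m) (Fin n) ℝ →ₗ[ℝ] EuclideanSpace ℝ (Fin l)}

theorem HasRIP.vectorRIP {r : ℕ} {α : ℝ} (hA : HasRIP A r α) (Z : Matrix (Fin m) (Fin n) ℝ) :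
    VectorRIP (singularValue Z) (fun j => A (singularMatrix Z j)) r α := by
  intro J c hJ
  have := hA.2 _ ((rank_sum_singularMatrix_le Z J c).trans hJ)
  rw [frobeniusNorm_sum_singularMatrix_sq] at this
  simpa only [map_sum, map_smul] using this

theorem frobeniusNorm_sum_singularMatrix_rpow (Z : Matrix (Fin m) (Fin n) ℝ) (J : Finset ℕ)
    (p : ℝ) : frobeniusNorm (∑ j ∈ J, singularMatrix Z j) ^ p =
      (∑ j ∈ J, singularValue Z j ^ 2) ^ (p / 2) := by
  have h := frobeniusNorm_sum_singularMatrix_sq Z J (fun _ => 1)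
  simp only [one_smul, one_mul] at h
  rw [← h, ← Real.rpow_natCast, ← Real.rpow_mul (frobeniusNorm_nonneg _)]
  congr 1
  push_cast
  ring

theorem HasRestrictedPIsometry.sum_singularMatrix {p β : ℝ} {r : ℕ}
    (hA : HasRestrictedPIsometry A p r β) (Z : Matrix (Fin m) (Fin n) ℝ) {J : Finset ℕ}
    (hJ : J.card ≤ r) :
    (1 - β) * (∑ j ∈ J, singularValue Z j ^ 2) ^ (p / 2) ≤
        ∑ i, |(∑ j ∈ J, A (singularMatrix Z j)) i| ^ p ∧
      ∑ i, |(∑ j ∈ J, A (singularMatrix Z j)) i| ^ p ≤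
        (1 + β) * (∑ j ∈ J, singularValue Z j ^ 2) ^ (p / 2) := by
  have hr := rank_sum_singularMatrix_le Z J (fun _ => 1)
  simp only [one_smul] at hr
  have := hA.2 _ (hr.trans hJ)
  rwa [frobeniusNorm_sum_singularMatrix_rpow, map_sum] at this

theorem sum_Ico_singularValue_rpow {p : ℝ} (hp0 : 0 < p) (hmn : m ≤ n)
    (Z : Matrix (Fin m) (Fin n) ℝ) (k : ℕ) :
    ∑ i ∈ Finset.Ico k n, singularValue Z i ^ p = ∑ i ∈ Finset.Ico k m, singularValue Z i ^ p := by
  refine (Finset.sum_subset (Finset.Ico_subset_Ico_right hmn) fun i hi hi' => ?_).symm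
  have hmi : m ≤ i := by
    simp only [Finset.mem_Ico] at hi hi'
    omega
  rw [(singularValue_eq_zero_iff Z i).2 (Z.rank_le_height.trans hmi), Real.zero_rpow hp0.ne']

theorem singularValue_eq_zero_of_width_le (Z : Matrix (Fin m) (Fin n) ℝ) {i : ℕ} (hi : n ≤ i) :
    singularValue Z i = 0 :=
  (singularValue_eq_zero_iff Z i).2 (Z.rank_le_width.trans hi)

theorem map_singularMatrix_of_width_le (Z : Matrix (Fin m) (Fin n) ℝ) {i : ℕ} (hi : n ≤ i) :
    A (singularMatrix Z i) = 0 := by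
  rw [singularMatrix_of_le Z hi, map_zero]

theorem sum_map_singularMatrix {Z : Matrix (Fin m) (Fin n) ℝ} (hZ : A Z = 0) :
    ∑ i ∈ Finset.range n, A (singularMatrix Z i) = 0 := by
  rw [← map_sum, sum_singularMatrix, hZ]

theorem HasRIP.sum_rpow_singularValue_lt {k : ℕ} {α p : ℝ} (hA : HasRIP A (2 * k) α) (hk : 1 ≤ k)
    (hmn : m ≤ n) (hp0 : 0 < p) (hp1 : p < 1) (hα : p < 1.0873 * (1 - α))
    {Z : Matrix (Fin m) (Fin n) ℝ} (hZ : A Z = 0) (hZ0 : Z ≠ 0) :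
    ∑ i ∈ Finset.range k, singularValue Z i ^ p < ∑ i ∈ Finset.Ico k m, singularValue Z i ^ p := by
  rw [← sum_Ico_singularValue_rpow hp0 hmn]
  exact (hA.vectorRIP Z).sum_rpow_lt (singularValue_antitone Z) (singularValue_nonneg Z)
    (singularValue_zero_pos hZ0) hp0 hp1 hk hA.1.1 hA.1.2 hα
    (fun _ => singularValue_eq_zero_of_width_le Z) (fun _ => map_singularMatrix_of_width_le Z)
    (sum_map_singularMatrix hZ)

theorem HasRestrictedPIsometry.sum_rpow_singularValue_lt {k M : ℕ} {b β₁ β₂ p : ℝ}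
    (hA₁ : HasRestrictedPIsometry A p M β₁) (hA₂ : HasRestrictedPIsometry A p (M + k) β₂)
    (hk : 1 ≤ k) (hmn : m ≤ n) (hp0 : 0 < p) (hp1 : p < 1) (hb : 1 < b)
    (hM : b ^ (2 / (2 - p)) * k ≤ M) (hβ : β₁ + b * β₂ < b - 1)
    {Z : Matrix (Fin m) (Fin n) ℝ} (hZ : A Z = 0) (hZ0 : Z ≠ 0) :
    ∑ i ∈ Finset.range k, singularValue Z i ^ p < ∑ i ∈ Finset.Ico k m, singularValue Z i ^ p := by
  rw [← sum_Ico_singularValue_rpow hp0 hmn]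
  exact sum_rpow_lt_of_restricted_pIsometry (singularValue_antitone Z) (singularValue_nonneg Z)
    (singularValue_zero_pos hZ0) hp0 hp1 hk hb hM hA₁.1.1 hA₂.1.2 hβ
    (fun _ => singularValue_eq_zero_of_width_le Z) (fun _ => map_singularMatrix_of_width_le Z)
    (sum_map_singularMatrix hZ) (fun J hJ => (hA₁.sum_singularMatrix Z hJ).2)
    fun J hJ => (hA₂.sum_singularMatrix Z hJ).1

end NullSpace

end SchattenRecovery

theorem mainTheorem4 (m n l : ℕ) (hmn : m ≤ n)
    (A : Matrix (Fin m) (Fin n) ℝ →ₗ[ℝ] EuclideanSpace ℝ (Fin l))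
    (p : ℝ) (hp0 : 0 < p) (hp1 : p < 1) :
    (∀ k : ℕ, 1 ≤ k → 2 * k ≤ m → ∀ α : ℝ, SchattenRecovery.HasRIP A (2 * k) α →
      p < min 1 (1.0873 * (1 - α)) →
      ∀ Xbar : Matrix (Fin m) (Fin n) ℝ, Xbar.rank ≤ k →
        SchattenRecovery.ExactlyRecovered A p Xbar) ∧
    (∀ k : ℕ, 1 ≤ k → ∀ b : ℝ, 1 < b →
      ∀ a : ℝ, a = (⌈b ^ (2 / (2 - p)) * (k : ℝ)⌉₊ : ℝ) / (k : ℝ) →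
      ∀ r₁ r₂ : ℕ, (r₁ : ℝ) = a * k → (r₂ : ℝ) = (a + 1) * k →
      ∀ β₁ β₂ : ℝ, SchattenRecovery.HasRestrictedPIsometry A p r₁ β₁ →
        SchattenRecovery.HasRestrictedPIsometry A p r₂ β₂ →
        β₁ + b * β₂ < b - 1 →
        ∀ Xbar : Matrix (Fin m) (Fin n) ℝ, Xbar.rank ≤ k →
          SchattenRecovery.ExactlyRecovered A p Xbar) := by
  refine ⟨fun k hk _ α hA hpα Xbar hX => ?_, ?_⟩
  · exact SchattenRecovery.exactlyRecovered_of_nullSpaceProperty hp0 hp1.le hmn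
      (fun Z hZ hZ0 => hA.sum_rpow_singularValue_lt hk hmn hp0 hp1 (lt_min_iff.1 hpα).2 hZ hZ0) hX
  · intro k hk b hb a ha r₁ r₂ hr₁ hr₂ β₁ β₂ hA₁ hA₂ hβ Xbar hX
    have hk0 : (k : ℝ) ≠ 0 := by exact_mod_cast (by omega : k ≠ 0)
    obtain rfl : r₂ = r₁ + k := by
      have : (r₂ : ℝ) = r₁ + k := by rw [hr₁, hr₂]; ring
      exact_mod_cast this
    have hM : b ^ (2 / (2 - p)) * k ≤ r₁ := by
      rw [hr₁, ha, div_mul_cancel₀ _ hk0]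
      exact Nat.le_ceil _
    exact SchattenRecovery.exactlyRecovered_of_nullSpaceProperty hp0 hp1.le hmn
      (fun Z hZ hZ0 => hA₁.sum_rpow_singularValue_lt hA₂ hk hmn hp0 hp1 hb hM hβ hZ hZ0) hX
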